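/- An \emph{exceptional class} in the $N$-fold blow-up $X_N$ of $\mathbb{CP}^2$ is a class $A=dL-\sum_{i=0}^{N-1} c_iE_i\in H_2(X_N;\mathbb Z)$ (with $L$ the class of a line and $E_i$ the classes of the exceptional divisors) such that $A\cdot A=-1$, $K\cdot A=-1$, that is, $d^2-\sum c_i^2=-1$ and $3d-\sum c_i=1$, and such that $A$ is represented by a smoothly embedded symplectic sphere. For coprime positive integers $p,q$, let $q\mathbf w(p/q)=(m_1,m_2,\dots)$ be the integral weight expansion of $p/q$: it consists of $\lfloor p/q\rfloor$ copies of $q$, followed by the integral weight expansion of $q/(p-\lfloor p/q\rfloor q)$ (which is empty if $q$ divides $p$). We write $(d,m;q\mathbf w(p/q))$ for the class $dL-mE_0-\sum_{i\ge1}m_iE_i$, call $p/q$ its center, and call the class \emph{perfect} if it is exceptional. A sequence of perfect classes $(d_k,m_k;q_k\mathbf w(p_k/q_k))$, $k\ge0$, is a \emph{perfect pre-staircase} with recursion parameter $\sigma$ and linear relation $R_0d=R_1p+R_2q$ if $\sigma\ge0$ is an integer with $\sigma+4$ a perfect square, $x_{k+1}=(\sigma+2)x_k-x_{k-1}$ for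 all $k\ge1$ and each of $x=d,m,p,q$, and $R_0d_k=R_1p_k+R_2q_k$ for all $k\ge0$. \textbf{Proposition.} Each of the following is a perfect pre-staircase with recursion parameter $\sigma_n=(2n+1)(2n+5)$, for each of the two choices $\mathrm{end}_n=2n+4$ and $\mathrm{end}_n=(2n+5,2n+2)$. The centers $p_k/q_k$, $k\ge0$, are given by their continued fractions, where $\{2n+5,2n+1\}^k$ denotes the pair repeated $k$ times; the $d_k$ are defined by the linear relation, and $m_k=3d_k-p_k-q_k$. \begin{itemize} \item $\mathcal S^L_{\ell,n}$, $n\ge0$: centers $[6;2n+1,\{2n+5,2n+1\}^k,\mathrm{end}_n]$, relation $(2n+3)d=(n+1)p-(n-1)q$; \item $\mathcal S^U_{u,n}$, $n\ge0$: centers $[2n+7;\{2n+5,2n+1\}^k,\mathrm{end}_n]$, relation $(2n+3)d=(n+2)p-(n+4)q$; \item $\mathcal S^E_{u,n}$, $n\ge0$: centers $[5;1,2n+6,\{2n+5,2n+1\}^k,\mathrm{end}_n]$, relation $(2n+3)d=-(n+4)p+(11n+31)q$; \item $\mathcal S^L_{u,n}$, $n\ge1$: centers $[6;2n-1,2n+1,\{2n+5,2n+1\}^k,\mathrm{end}_n]$,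 relation $(2n+3)d=-(n-1)p+(11n+2)q$; \item $\mathcal S^U_{\ell,n}$, $n\ge1$: centers $[\{2n+5,2n+1\}^k,\mathrm{end}_n]$, relation $(2n+3)d=(n+1)p+(n+2)q$; \item $\mathcal S^E_{\ell,n}$, $n\ge1$: centers $[5;1,2n+4,2n+1,\{2n+5,2n+1\}^k,\mathrm{end}_n]$, relation $(2n+3)d=(n+2)p-(n+4)q$. \end{itemize} In particular, all the $d_k$ and $m_k$ are integers and all these classes are exceptional. Moreover, with $g_k$ the Fibonacci number $F_{2k+1}$ (so $g_0,g_1,g_2,\dots=1,2,5,13,\dots$), all the classes $\bigl(g_{k+1},0;\,g_k\mathbf w(g_{k+2}/g_k)\bigr)$, $k\ge0$, of the Fibonacci staircase (of which $\mathcal S^L_{\ell,0}$ is a tail) are exceptional, and those with $k$ even and those with $k$ odd each form a perfect pre-staircase with $\sigma=5$ and relation $3d=p+q$. -/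

import Mathlib

open scoped LinearAlgebra.Projectivization ContDiff

/-! ### Blow-ups of the complex projective plane and symplectic spheres in them -/

/-- The complex projective plane. -/
abbrev CP2 : Type := ℙ ℂ (Fin 3 → ℂ)

/-- The `N`-fold blow-up of the plane at the points `p 0, …, p (N - 1)`, as a complex
submanifold of `CP2 × CP2 ^ N`.  It consists of the tuples `(x, ℓ 0, …, ℓ (N - 1))` in which
`ℓ i` is (the equation of) a line through `p i` that also passes through `x`.  The lines through
`p i` form a projective line; away from `p i` the line `ℓ i` is determined by `x`, and the fibre
over `p i` is the exceptional divisor `E i`.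

For distinct points `p i` this is a model of the connected sum of `CP2` with `N` copies of `CP2`
with reversed orientation.  In terms of the basis `L, E 0, …, E (N - 1)` of the second homology,
the projection to the coordinate `x` pulls the hyperplane class back to the class dual to `L`,
and the projection to the coordinate `ℓ i` pulls it back to the class dual to `L - E i`. -/
def blowUp {N : ℕ} (p : Fin N → CP2) : Set (CP2 × (Fin N → CP2)) :=
  {y | ∀ i, Projectivization.orthogonal (y.2 i) (p i) ∧
    Projectivization.orthogonal (y.2 i) y.1}

/-- A smooth map from the two-sphere `ℂ ∪ {∞}` to the projective plane, written in homogeneous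
coordinates: `u` in the chart `z`, and `v` in the chart `w = 1 / z` at infinity.  The exponent of
the transition function says that the pull-back of the hyperplane bundle has degree `deg`, so
`deg` is the degree of the map: the intersection number of its image with a line.  Every smooth
map to the plane is of this form, for exactly one value of `deg`. -/
structure SmoothSphere where
  u : ℂ → Fin 3 → ℂ
  v : ℂ → Fin 3 → ℂ
  smooth_u : ContDiff ℝ ∞ u
  smooth_v : ContDiff ℝ ∞ v
  u_ne_zero : ∀ z, u z ≠ 0
  v_ne_zero : ∀ w, v w ≠ 0
  deg : ℤ
  glue : ∀ z, z ≠ 0 → u z = z ^ deg • v z⁻¹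

/-- The underlying map `ℂ ∪ {∞} → CP2`. -/
noncomputable def SmoothSphere.toMap (f : SmoothSphere) (s : OnePoint ℂ) : CP2 :=
  s.elim (Projectivization.mk ℂ (f.v 0) (f.v_ne_zero 0))
    (fun z => Projectivization.mk ℂ (f.u z) (f.u_ne_zero z))

/-- The Fubini-Study two-form of the projective plane in homogeneous coordinates, at the point
`[u]` and on the tangent vectors represented by `a` and `b`:
`Im (⟨a, b⟩ ⟨u, u⟩ - ⟨a, u⟩ ⟨u, b⟩) / ⟨u, u⟩ ^ 2`. -/
noncomputable def fubiniStudy (u a b : Fin 3 → ℂ) : ℝ :=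
  ((star a ⬝ᵥ b) * (star u ⬝ᵥ u) - (star a ⬝ᵥ u) * (star u ⬝ᵥ b)).im /
    ((star u ⬝ᵥ u).re) ^ 2

/-- The density, with respect to `ds ∧ dt` in the coordinate `z = s + t i`, of the pull-back of the
Fubini-Study form under `z ↦ [u z]`. -/
noncomputable def fsDensity (u : ℂ → Fin 3 → ℂ) (z : ℂ) : ℝ :=
  fubiniStudy (u z) (fderiv ℝ u z 1) (fderiv ℝ u z Complex.I)

/-- The class `d L - ∑ c i E i` in the `N`-fold blow-up of the plane, with `c` the list of its
`N` coefficients, is represented by a smoothly embedded symplectic sphere.  The sphere is given by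
the components `x` and `ℓ i` of a map from `ℂ ∪ {∞}` to the blow-up.  The symplectic form is the
restriction to the blow-up of the sum of the Fubini-Study forms of all the factors; it is a Kähler
form, so its canonical class is the standard one.  A map whose pull-back of this form is
everywhere positive is an orientation-preserving symplectic immersion, and an embedding as soon
as it is injective.  The degrees of the components are the pairings of the class with
`L` and with `L - E i`, namely `d` and `d - c i`; they determine the class. -/
def RepresentedBySymplecticSphere (d : ℤ) (c : List ℤ) : Prop :=
  ∃ p : Fin c.length → CP2, Function.Injective p ∧
    ∃ (x : SmoothSphere) (l : Fin c.length → SmoothSphere),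
      (∀ s, (x.toMap s, fun i => (l i).toMap s) ∈ blowUp p) ∧
      Function.Injective (fun s => (x.toMap s, fun i => (l i).toMap s)) ∧
      (∀ z, 0 < fsDensity x.u z + ∑ i, fsDensity (l i).u z) ∧
      (∀ w, 0 < fsDensity x.v w + ∑ i, fsDensity (l i).v w) ∧
      x.deg = d ∧ ∀ i, (l i).deg = d - c.get i

/-- `(d; c)`, that is the class `A = d L - ∑ c i E i`, is a Diophantine class:
`A · A = -1` and `K · A = -1`. -/
def IsDiophantine (d : ℤ) (c : List ℤ) : Prop :=
  d ^ 2 - (c.map (· ^ 2)).sum = -1 ∧ 3 * d - c.sum = 1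

/-- `(d; c)`, that is the class `A = d L - ∑ c i E i`, is an exceptional class: `A · A = -1`,
`K · A = -1`, and `A` is represented by a smoothly embedded symplectic sphere. -/
def IsExceptional (d : ℤ) (c : List ℤ) : Prop :=
  IsDiophantine d c ∧ RepresentedBySymplecticSphere d c

/-! ### Continued fractions, weight expansions, perfect classes, pre-staircases -/

/-- The numerator and denominator, in lowest terms, of the continued fraction
`[ℓ₀; ℓ₁, …, ℓ_N] = ℓ₀ + 1 / [ℓ₁; …, ℓ_N]`; the empty list stands for `1 / 0`. -/
def contFrac : List ℕ → ℕ × ℕ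
  | [] => (1, 0)
  | a :: l => (a * (contFrac l).1 + (contFrac l).2, (contFrac l).1)

/-- The integral weight expansion `q w(p / q)` of a fraction `p / q` in lowest terms:
`⌊p / q⌋` copies of `q`, followed by the integral weight expansion of `q / (p - ⌊p / q⌋ q)`. -/
def intWeights (p q : ℕ) : List ℤ :=
  if q = 0 then [] else List.replicate (p / q) (q : ℤ) ++ intWeights q (p % q)
termination_by q
decreasing_by exact Nat.mod_lt _ (Nat.pos_of_ne_zero ‹_›)

/-- `(d, m; q w(p / q)) = d L - m E₀ - ∑_{i ≥ 1} m_i E_i`, with `(m₁, m₂, …) = q w(p / q)`, is a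
perfect class with center `p / q`. -/
def IsPerfect (d m : ℤ) (p q : ℕ) : Prop :=
  0 < q ∧ p.Coprime q ∧ IsExceptional d (m :: intWeights p q)

/-- The classes `(d k, m k; q k w(p k / q k))`, for `k ≥ 0`, form a perfect pre-staircase with
recursion parameter `σ` and linear relation `R₀ d = R₁ p + R₂ q`. -/
structure IsPerfectPreStaircase (σ R₀ R₁ R₂ : ℤ) (d m : ℕ → ℤ) (p q : ℕ → ℕ) : Prop where
  sigma_nonneg : 0 ≤ σ
  isSquare : IsSquare (σ + 4)
  recursion_d : ∀ k, d (k + 2) = (σ + 2) * d (k + 1) - d k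
  recursion_m : ∀ k, m (k + 2) = (σ + 2) * m (k + 1) - m k
  recursion_p : ∀ k, (p (k + 2) : ℤ) = (σ + 2) * p (k + 1) - p k
  recursion_q : ∀ k, (q (k + 2) : ℤ) = (σ + 2) * q (k + 1) - q k
  relation : ∀ k, R₀ * d k = R₁ * p k + R₂ * q k
  perfect : ∀ k, IsPerfect (d k) (m k) (p k) (q k)

/-- The continued fraction `[pre, {2n+5, 2n+1}^k, tail]`, where the pair is repeated `k` times. -/
def stairCF (n : ℕ) (pre tail : List ℕ) (k : ℕ) : ℕ × ℕ :=
  contFrac (pre ++ (List.replicate k [2 * n + 5, 2 * n + 1]).flatten ++ tail)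

/-- The pre-staircases with parameter `n`, with centers `[pre, {2n+5, 2n+1}^k, end]`, `k ≥ 0`, and
with linear relation `(2n+3) d = R₁ p + R₂ q` are well defined and perfect, for both choices
`2n+4` and `2n+5, 2n+2` of `end`.  The degrees `d k` are determined by the linear relation, and
the `m k` by the equation `3 d = m + p + q`, which is one of the Diophantine equations. -/
def StaircasePerfect (n : ℕ) (pre : List ℕ) (R₁ R₂ : ℤ) : Prop :=
  ∀ tail ∈ [[2 * n + 4], [2 * n + 5, 2 * n + 2]], ∃ d m : ℕ → ℤ,
    IsPerfectPreStaircase ((2 * n + 1) * (2 * n + 5)) (2 * n + 3) R₁ R₂ d m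
      (fun k => (stairCF n pre tail k).1) (fun k => (stairCF n pre tail k).2)

/-! Quadratic Cremona transformations preserve both Diophantine equations and, for a dense set of
point configurations, representability by embedded rational curves. Hence it suffices to reach each
class from the exceptional divisor `(0; -1)` by such moves, after adding points of multiplicity
zero.

Geometry. A rational curve in the blow-up is a tuple of sections on the two charts of the Riemann
sphere. The inversion `x j ↦ 1 / x j` interchanges the equations of the exceptional divisors over
the coordinate points with those of the coordinate lines, which gives the transformed curve
explicitly (`HasCurve.cremona_coordPt`). Embeddedness is stated for points with values in local
`ℂ`-algebras: that form passes through the transformation, over `ℂ` it is injectivity, and over the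
dual numbers it is immersivity. The transformation is a continuous involution on an open dense set
of configurations, so density persists (`dense_hasCurve_cremona`). A holomorphic embedded curve is
symplectic for the Kähler form (`HasCurve.representedBySymplecticSphere`).

Arithmetic. Let `r / s` be the value of a periodic tail with its end, and `r - s = (2n+3) a`. The
class of degree `r - (n+2) a` whose multiplicities are `r - (n+3) a` and the weights of `r / s` is
reached by induction on the number of periods (`TailStable.next`). Each of the six staircases arises
from it by a few de Jonquières moves (`IsStable.flips_same`) and at most one quintic involution
(`IsStable.quintic`). So `d, m, p, q` are fixed linear combinations of `r` and `a`; these satisfy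
the recursion, and the linear relation is an identity between coefficients
(`StaircasePerfect.of_tailStable`). In the Fibonacci staircase one de Jonquières move and one
quintic lead from step `k` to step `k + 2` (`isStable_fib`). -/

/-! ### Sections of line bundles on the Riemann sphere -/

/-- Pairs of polynomials, one for each of the two standard charts of the Riemann sphere. -/
abbrev BiPoly : Type := Polynomial ℂ × Polynomial ℂ

namespace BiPoly

open Polynomial

/-- The pair `a` is a section of the line bundle of degree `k`. -/
def HasDeg (k : ℤ) (a : BiPoly) : Prop :=
  ∀ z : ℂ, z ≠ 0 → a.1.eval z = z ^ k * a.2.eval z⁻¹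

/-- The homogeneous coordinate that vanishes at `0`. -/
noncomputable def T0 : BiPoly := (X, 1)

/-- The homogeneous coordinate that vanishes at `∞`. -/
noncomputable def T1 : BiPoly := (1, X)

/-- Constants. -/
noncomputable def const : ℂ →+* BiPoly := algebraMap ℂ BiPoly

theorem hasDeg_zero (k : ℤ) : HasDeg k 0 := by
  intro z _; simp

theorem hasDeg_const (t : ℂ) : HasDeg 0 (const t) := by
  intro z _; simp [const, Prod.algebraMap_apply]

theorem hasDeg_one : HasDeg 0 1 := by
  intro z _; simp

theorem hasDeg_T0 : HasDeg 1 T0 := by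
  intro z _; simp [T0]

theorem hasDeg_T1 : HasDeg 1 T1 := by
  intro z hz; simp [T1, hz]

namespace HasDeg

variable {k k' j : ℤ} {a b : BiPoly}

theorem add (ha : HasDeg k a) (hb : HasDeg k b) : HasDeg k (a + b) := by
  intro z hz; simp [ha z hz, hb z hz]; ring

theorem neg (ha : HasDeg k a) : HasDeg k (-a) := by
  intro z hz; simp [ha z hz]

theorem sub (ha : HasDeg k a) (hb : HasDeg k b) : HasDeg k (a - b) := by
  rw [sub_eq_add_neg]; exact ha.add hb.neg

theorem mul (ha : HasDeg k a) (hb : HasDeg k' b) (h : j = k + k') : HasDeg j (a * b) := by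
  intro z hz; simp [ha z hz, hb z hz, h, zpow_add₀ hz]; ring

theorem const_mul (t : ℂ) (ha : HasDeg k a) : HasDeg k (const t * a) :=
  (hasDeg_const t).mul ha (zero_add k).symm

/-- The degree of a common cofactor of two coprime sections. -/
theorem of_mul_coprime {e f s : BiPoly} {k₁ k₂ : ℤ} (he : HasDeg k₁ e) (hf : HasDeg k₂ f)
    (hcop : IsCoprime e f) (hes : HasDeg (k₁ + k) (e * s)) (hfs : HasDeg (k₂ + k) (f * s)) :
    HasDeg k s := by
  obtain ⟨u, v, huv⟩ := hcop
  -- By Bézout `e` and `f` do not vanish together, so at each point one can divide by one of them.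
  have key : ∀ (e : BiPoly) (k₁ : ℤ), HasDeg k₁ e → HasDeg (k₁ + k) (e * s) →
      ∀ z : ℂ, z ≠ 0 → e.1.eval z ≠ 0 → s.1.eval z = z ^ k * s.2.eval z⁻¹ := by
    intro e k₁ he hes z hz h0
    have h1 := hes z hz
    have h2 := he z hz
    simp only [Prod.fst_mul, Prod.snd_mul, eval_mul, zpow_add₀ hz] at h1
    apply mul_left_cancel₀ h0
    rw [h1, h2]; ring
  intro z hz
  by_cases h : e.1.eval z = 0
  · refine key f k₂ hf hfs z hz fun h' => ?_
    have := congrArg (fun t : BiPoly => t.1.eval z) huv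
    simp [h, h'] at this
  · exact key e k₁ he hes z hz h

end HasDeg

/-- Two elements without a common zero in any field are coprime. -/
theorem isCoprime_of_forall_field {e f : BiPoly}
    (h : ∀ (K : Type) [Field K] (φ : BiPoly →+* K), φ e = 0 → φ f = 0 → False) :
    IsCoprime e f := by
  by_contra hc
  have hne : Ideal.span {e, f} ≠ ⊤ := by
    intro htop
    apply hc
    have h1 : (1 : BiPoly) ∈ Ideal.span {e, f} := htop ▸ Submodule.mem_top
    obtain ⟨u, v, huv⟩ := Ideal.mem_span_pair.1 h1
    exact ⟨u, v, huv⟩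
  obtain ⟨M, hM, hle⟩ := Ideal.exists_le_maximal _ hne
  let _ := Ideal.Quotient.field M
  refine h (BiPoly ⧸ M) (Ideal.Quotient.mk M) ?_ ?_
  · exact Ideal.Quotient.eq_zero_iff_mem.2 (hle (Ideal.subset_span (by simp)))
  · exact Ideal.Quotient.eq_zero_iff_mem.2 (hle (Ideal.subset_span (by simp)))

theorem map_const_ne_zero {K : Type} [Field K] (φ : BiPoly →+* K) {t : ℂ} (ht : t ≠ 0) :
    φ (const t) ≠ 0 :=
  ((ht.isUnit.map const).map φ).ne_zero

theorem algHom_const {R : Type*} [CommRing R] [Algebra ℂ R] (φ : BiPoly →ₐ[ℂ] R) (t : ℂ) :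
    φ (const t) = algebraMap ℂ R t :=
  φ.commutes t

end BiPoly

/-- A factorization of two coprime multiples of the same element. -/
theorem IsCoprime.exists_common_cofactor {A : Type*} [CommRing A] {e f a b : A}
    (h : IsCoprime e f) (hab : e * a = f * b) : ∃ s, a = f * s ∧ b = e * s := by
  obtain ⟨u, v, huv⟩ := h
  refine ⟨u * b + v * a, ?_, ?_⟩
  · linear_combination (-a) * huv + u * hab
  · linear_combination (-b) * huv - v * hab

/-! ### Rational curves in blow-ups of the plane -/

/-- The vectors `a` and `b` are parallel. -/
def Par {R : Type*} [CommRing R] (a b : Fin 3 → R) : Prop := ∀ i j, a i * b j = a j * b i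

theorem par_iff {R : Type*} [CommRing R] {a b : Fin 3 → R} :
    Par a b ↔ a 0 * b 1 = a 1 * b 0 ∧ a 0 * b 2 = a 2 * b 0 ∧ a 1 * b 2 = a 2 * b 1 := by
  constructor
  · intro h; exact ⟨h _ _, h _ _, h _ _⟩
  · rintro ⟨h1, h2, h3⟩ i j
    fin_cases i <;> fin_cases j <;> simp_all

open BiPoly in
/-- The homogeneous coordinates `x`, `l i` parametrize an embedded rational curve in the blow-up of
the plane at the points `P i`, of degree `d` and with multiplicity `c i` at `P i`; `e i` is the
pull-back of the section that defines the `i`-th exceptional divisor.  Embeddedness is expressed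
in terms of points with values in local rings. -/
structure IsCurve {ι : Type} (P : ι → Fin 3 → ℂ) (d : ℤ) (c : ι → ℤ)
    (x : Fin 3 → BiPoly) (e : ι → BiPoly) (l : ι → Fin 3 → BiPoly) : Prop where
  deg_x : ∀ j, HasDeg d (x j)
  deg_e : ∀ i, HasDeg (c i) (e i)
  deg_l : ∀ i j, HasDeg (d - c i) (l i j)
  cross0 : ∀ i, const (P i 1) * x 2 - const (P i 2) * x 1 = e i * l i 0
  cross1 : ∀ i, const (P i 2) * x 0 - const (P i 0) * x 2 = e i * l i 1
  cross2 : ∀ i, const (P i 0) * x 1 - const (P i 1) * x 0 = e i * l i 2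
  incid_pt : ∀ i, l i 0 * const (P i 0) + l i 1 * const (P i 1) + l i 2 * const (P i 2) = 0
  incid : ∀ i, l i 0 * x 0 + l i 1 * x 1 + l i 2 * x 2 = 0
  x_ne : ∀ (K : Type) [Field K] (φ : BiPoly →+* K),
    φ (x 0) = 0 → φ (x 1) = 0 → φ (x 2) = 0 → False
  l_ne : ∀ i (K : Type) [Field K] (φ : BiPoly →+* K),
    φ (l i 0) = 0 → φ (l i 1) = 0 → φ (l i 2) = 0 → False
  sep : ∀ (R : Type) [CommRing R] [Algebra ℂ R] [IsLocalRing R] (φ ψ : BiPoly →ₐ[ℂ] R),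
    Par (fun j => φ (x j)) (fun j => ψ (x j)) →
    (∀ i, Par (fun j => φ (l i j)) (fun j => ψ (l i j))) → φ T0 * ψ T1 = φ T1 * ψ T0

/-- There is an embedded rational curve of degree `d` and with multiplicities `c` at `P`. -/
def HasCurve {ι : Type} (P : ι → Fin 3 → ℂ) (d : ℤ) (c : ι → ℤ) : Prop :=
  ∃ x e l, IsCurve P d c x e l

theorem HasCurve.reindex {ι κ : Type} {P : ι → Fin 3 → ℂ} {d : ℤ} {c : ι → ℤ} (σ : κ ≃ ι)
    (h : HasCurve P d c) : HasCurve (P ∘ σ) d (c ∘ σ) := by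
  obtain ⟨x, e, l, h⟩ := h
  exact ⟨x, e ∘ σ, l ∘ σ, h.deg_x, fun i => h.deg_e _, fun i => h.deg_l _, fun i => h.cross0 _,
    fun i => h.cross1 _, fun i => h.cross2 _, fun i => h.incid_pt _, fun i => h.incid _, h.x_ne,
    fun i => h.l_ne _, fun R _ _ _ φ ψ hx hl =>
      h.sep R φ ψ hx fun i => by simpa using hl (σ.symm i)⟩

/-! ### Projective transformations -/

section LinearAction

open BiPoly Matrix

/-- The minors of the images are combinations of the old minors, with minors of `B` as coefficients.
-/
theorem Par.mulVec {R : Type*} [CommRing R] {a b a' b' : Fin 3 → R} {B : Fin 3 → Fin 3 → R}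
    (h : Par a b) (ha : ∀ i, a' i = B i 0 * a 0 + B i 1 * a 1 + B i 2 * a 2)
    (hb : ∀ i, b' i = B i 0 * b 0 + B i 1 * b 1 + B i 2 * b 2) : Par a' b' := by
  obtain ⟨h1, h2, h3⟩ := par_iff.1 h
  intro i j
  rw [ha, ha, hb, hb]
  linear_combination (B i 0 * B j 1 - B i 1 * B j 0) * h1 + (B i 0 * B j 2 - B i 2 * B j 0) * h2 +
    (B i 1 * B j 2 - B i 2 * B j 1) * h3

/-- Projective transformations move curves. -/
theorem HasCurve.mulVec {ι : Type} {P : ι → Fin 3 → ℂ} {d : ℤ} {c : ι → ℤ}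
    (g h : Matrix (Fin 3) (Fin 3) ℂ) (hgh : h * g = 1)
    (hP : HasCurve P d c) : HasCurve (fun i => g *ᵥ P i) d c := by
  obtain ⟨x, e, l, H⟩ := hP
  have hdet : g.det ≠ 0 := by
    intro h0
    have := congrArg det hgh
    simp [h0] at this
  have hgh' : g * h = 1 := mul_eq_one_comm.1 hgh
  have hg : ∀ i j, g i 0 * h 0 j + g i 1 * h 1 j + g i 2 * h 2 j = if i = j then 1 else 0 := by
    intro i j
    have := congrFun (congrFun hgh' i) j
    simpa [Matrix.mul_apply, Fin.sum_univ_three, Matrix.one_apply] using this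
  have hh : ∀ i j, h i 0 * g 0 j + h i 1 * g 1 j + h i 2 * g 2 j = if i = j then 1 else 0 := by
    intro i j
    have := congrFun (congrFun hgh i) j
    simpa [Matrix.mul_apply, Fin.sum_univ_three, Matrix.one_apply] using this
  -- The cross product of `g P` and `g x` is the transposed adjugate of `g` applied to the cross
  -- product of `P` and `x`. Hence the factor `det g` in the new `e` and the transposed inverse in
  -- the new `l`.
  have hadj : ∀ i j, g.adjugate i j = g.det * h i j := by
    intro i j
    have : g.adjugate = g.det • h := by
      calc g.adjugate = g.adjugate * (g * h) := by rw [hgh', mul_one]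
        _ = g.det • h := by rw [← mul_assoc, adjugate_mul]; simp
    rw [this]; rfl
  have c' : ∀ {s t : ℂ}, s = t → const s = const t := fun h => congrArg const h
  have hgA := fun i j => c' (hg i j)
  have hhA := fun i j => c' (hh i j)
  have hadjA := fun i j => c' (hadj i j)
  rw [Matrix.adjugate_fin_three] at hadjA
  simp only [map_add, map_mul] at hgA hhA hadjA
  have hA00 := hadjA 0 0
  have hA01 := hadjA 0 1
  have hA02 := hadjA 0 2
  have hA10 := hadjA 1 0
  have hA11 := hadjA 1 1
  have hA12 := hadjA 1 2
  have hA20 := hadjA 2 0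
  have hA21 := hadjA 2 1
  have hA22 := hadjA 2 2
  simp at hA00 hA01 hA02 hA10 hA11 hA12 hA20 hA21 hA22
  let x' : Fin 3 → BiPoly := fun i =>
    const (g i 0) * x 0 + const (g i 1) * x 1 + const (g i 2) * x 2
  let l' : ι → Fin 3 → BiPoly := fun k i =>
    const (h 0 i) * l k 0 + const (h 1 i) * l k 1 + const (h 2 i) * l k 2
  have hx : ∀ i, x i = const (h i 0) * x' 0 + const (h i 1) * x' 1 + const (h i 2) * x' 2 := by
    intro i
    have h0 := hhA i 0
    have h1 := hhA i 1
    have h2 := hhA i 2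
    fin_cases i <;> simp at h0 h1 h2 ⊢ <;> simp only [x'] <;>
      linear_combination (-x 0) * h0 + (-x 1) * h1 + (-x 2) * h2
  have hl : ∀ k i, l k i = const (g 0 i) * l' k 0 + const (g 1 i) * l' k 1
      + const (g 2 i) * l' k 2 := by
    intro k i
    have h0 := hhA 0 i
    have h1 := hhA 1 i
    have h2 := hhA 2 i
    fin_cases i <;> simp at h0 h1 h2 ⊢ <;> simp only [l'] <;>
      linear_combination (-l k 0) * h0 + (-l k 1) * h1 + (-l k 2) * h2
  have hPi : ∀ k i, const ((g *ᵥ P k) i) = const (g i 0) * const (P k 0) +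
      const (g i 1) * const (P k 1) + const (g i 2) * const (P k 2) := by
    intro k i
    simp [Matrix.mulVec, dotProduct, Fin.sum_univ_three]
  have hdot : ∀ k (y y' : Fin 3 → BiPoly), (∀ i, y' i =
      const (g i 0) * y 0 + const (g i 1) * y 1 + const (g i 2) * y 2) →
      l' k 0 * y' 0 + l' k 1 * y' 1 + l' k 2 * y' 2 = l k 0 * y 0 + l k 1 * y 1 + l k 2 * y 2 := by
    intro k y y' hy
    rw [hl k 0, hl k 1, hl k 2, hy, hy, hy]
    ring
  refine ⟨x', fun k => const g.det * e k, l', ?_, ?_, ?_, ?_, ?_, ?_, ?_, ?_, ?_, ?_, ?_⟩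
  · intro j
    exact (((H.deg_x 0).const_mul _).add ((H.deg_x 1).const_mul _)).add ((H.deg_x 2).const_mul _)
  · intro i
    exact (H.deg_e i).const_mul _
  · intro i j
    exact (((H.deg_l i 0).const_mul _).add ((H.deg_l i 1).const_mul _)).add
      ((H.deg_l i 2).const_mul _)
  · intro k
    rw [hPi, hPi]
    simp only [x', l']
    linear_combination const g.det * const (h 0 0) * H.cross0 k +
      const g.det * const (h 1 0) * H.cross1 k +
      const g.det * const (h 2 0) * H.cross2 k +
      (const (P k 1) * x 2 - const (P k 2) * x 1) * hA00 +
      (const (P k 2) * x 0 - const (P k 0) * x 2) * hA10 +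
      (const (P k 0) * x 1 - const (P k 1) * x 0) * hA20
  · intro k
    rw [hPi, hPi]
    simp only [x', l']
    linear_combination const g.det * const (h 0 1) * H.cross0 k +
      const g.det * const (h 1 1) * H.cross1 k +
      const g.det * const (h 2 1) * H.cross2 k +
      (const (P k 1) * x 2 - const (P k 2) * x 1) * hA01 +
      (const (P k 2) * x 0 - const (P k 0) * x 2) * hA11 +
      (const (P k 0) * x 1 - const (P k 1) * x 0) * hA21
  · intro k
    rw [hPi, hPi]
    simp only [x', l']
    linear_combination const g.det * const (h 0 2) * H.cross0 k +
      const g.det * const (h 1 2) * H.cross1 k +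
      const g.det * const (h 2 2) * H.cross2 k +
      (const (P k 1) * x 2 - const (P k 2) * x 1) * hA02 +
      (const (P k 2) * x 0 - const (P k 0) * x 2) * hA12 +
      (const (P k 0) * x 1 - const (P k 1) * x 0) * hA22
  · intro k
    exact (hdot k (fun i => const (P k i)) (fun i => const ((g *ᵥ P k) i)) (hPi k)).trans
      (H.incid_pt k)
  · intro k
    exact (hdot k x x' fun i => rfl).trans (H.incid k)
  · intro K _ φ h0 h1 h2
    apply H.x_ne K φ <;> rw [hx] <;> simp [h0, h1, h2]
  · intro k K _ φ h0 h1 h2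
    apply H.l_ne k K φ <;> rw [hl] <;> simp [h0, h1, h2]
  · intro R _ _ _ φ ψ hpx hpl
    apply H.sep R φ ψ
    · have hx' : ∀ (φ : BiPoly →ₐ[ℂ] R) i, φ (x i) = algebraMap ℂ R (h i 0) * φ (x' 0) +
          algebraMap ℂ R (h i 1) * φ (x' 1) + algebraMap ℂ R (h i 2) * φ (x' 2) := by
        intro φ i
        rw [hx i, map_add, map_add, map_mul, map_mul, map_mul, algHom_const, algHom_const,
          algHom_const]
      exact Par.mulVec (B := fun i j => algebraMap ℂ R (h i j)) hpx (hx' φ) (hx' ψ)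
    · intro k
      have hl' : ∀ (φ : BiPoly →ₐ[ℂ] R) i, φ (l k i) = algebraMap ℂ R (g 0 i) * φ (l' k 0) +
          algebraMap ℂ R (g 1 i) * φ (l' k 1) + algebraMap ℂ R (g 2 i) * φ (l' k 2) := by
        intro φ i
        rw [hl k i, map_add, map_add, map_mul, map_mul, map_mul, algHom_const, algHom_const,
          algHom_const]
      exact Par.mulVec (B := fun i j => algebraMap ℂ R (g j i)) (hpl k) (hl' φ) (hl' ψ)

end LinearAction

/-! ### The quadratic Cremona transformation -/

open BiPoly

/-- The coordinate points of the plane. -/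
def coordPt : Fin 3 → Fin 3 → ℂ := ![![1, 0, 0], ![0, 1, 0], ![0, 0, 1]]

/-- Where `e i` vanishes, `x` is a nonzero multiple of `P i`. -/
theorem IsCurve.x_ne_zero_of_e_eq_zero {ι : Type} {P : ι → Fin 3 → ℂ} {d : ℤ} {c : ι → ℤ}
    {x : Fin 3 → BiPoly} {e : ι → BiPoly} {l : ι → Fin 3 → BiPoly} (H : IsCurve P d c x e l)
    {i : ι} (hP : ∀ j, P i j ≠ 0) {K : Type} [Field K] (φ : BiPoly →+* K) (he : φ (e i) = 0)
    (j : Fin 3) : φ (x j) ≠ 0 := by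
  have h0 := congrArg φ (H.cross0 i)
  have h1 := congrArg φ (H.cross1 i)
  have h2 := congrArg φ (H.cross2 i)
  have n0 := map_const_ne_zero φ (hP 0)
  have n1 := map_const_ne_zero φ (hP 1)
  have n2 := map_const_ne_zero φ (hP 2)
  have nx := H.x_ne K φ
  simp only [map_sub, map_mul, he, zero_mul] at h0 h1 h2
  intro hj
  fin_cases j <;> simp only [Fin.zero_eta, Fin.mk_one, Fin.reduceFinMk] at hj <;>
    simp_all

/-- Homogeneous coordinates of a curve in the blow-up of the plane at the coordinate points and at
the points `Q i`: the pull-backs `E j`, `s j` of the equations of the exceptional divisors over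
the coordinate points and of the lines through pairs of these. -/
structure IsToricCurve {κ : Type} (Q : κ → Fin 3 → ℂ) (d : ℤ) (a : Fin 3 → ℤ) (b : κ → ℤ)
    (E0 E1 E2 s0 s1 s2 : BiPoly) (e m0 m1 m2 : κ → BiPoly) : Prop where
  dE0 : HasDeg (a 0) E0
  dE1 : HasDeg (a 1) E1
  dE2 : HasDeg (a 2) E2
  ds0 : HasDeg (d - a 1 - a 2) s0
  ds1 : HasDeg (d - a 0 - a 2) s1
  ds2 : HasDeg (d - a 0 - a 1) s2
  de : ∀ i, HasDeg (b i) (e i)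
  dm0 : ∀ i, HasDeg (d - b i - a 0) (m0 i)
  dm1 : ∀ i, HasDeg (d - b i - a 1) (m1 i)
  dm2 : ∀ i, HasDeg (d - b i - a 2) (m2 i)
  w0 : ∀ i, const (Q i 1) * E1 * s2 - const (Q i 2) * E2 * s1 = e i * m0 i
  w1 : ∀ i, const (Q i 2) * E2 * s0 - const (Q i 0) * E0 * s2 = e i * m1 i
  w2 : ∀ i, const (Q i 0) * E0 * s1 - const (Q i 1) * E1 * s0 = e i * m2 i
  ms : ∀ i, s0 * m0 i + s1 * m1 i + s2 * m2 i = 0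
  mp : ∀ i, E0 * m0 i * const (Q i 0) + E1 * m1 i * const (Q i 1) + E2 * m2 i * const (Q i 2) = 0
  ne0 : ∀ (K : Type) [Field K] (φ : BiPoly →+* K), φ E1 * φ s2 = 0 → φ E2 * φ s1 = 0 → False
  ne1 : ∀ (K : Type) [Field K] (φ : BiPoly →+* K), φ E0 * φ s2 = 0 → φ E2 * φ s0 = 0 → False
  ne2 : ∀ (K : Type) [Field K] (φ : BiPoly →+* K), φ E0 * φ s1 = 0 → φ E1 * φ s0 = 0 → False
  nex : ∀ (K : Type) [Field K] (φ : BiPoly →+* K), φ E1 * φ E2 * φ s0 = 0 →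
    φ E0 * φ E2 * φ s1 = 0 → φ E0 * φ E1 * φ s2 = 0 → False
  nel : ∀ i (K : Type) [Field K] (φ : BiPoly →+* K), φ E0 * φ (m0 i) = 0 →
    φ E1 * φ (m1 i) = 0 → φ E2 * φ (m2 i) = 0 → False
  sep : ∀ (R : Type) [CommRing R] [Algebra ℂ R] [IsLocalRing R] (φ ψ : BiPoly →ₐ[ℂ] R),
    φ E1 * φ s2 * (ψ E2 * ψ s1) = φ E2 * φ s1 * (ψ E1 * ψ s2) →
    φ E0 * φ s2 * (ψ E2 * ψ s0) = φ E2 * φ s0 * (ψ E0 * ψ s2) →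
    φ E0 * φ s1 * (ψ E1 * ψ s0) = φ E1 * φ s0 * (ψ E0 * ψ s1) →
    (∀ i, Par ![φ E0 * φ (m0 i), φ E1 * φ (m1 i), φ E2 * φ (m2 i)]
      ![ψ E0 * ψ (m0 i), ψ E1 * ψ (m1 i), ψ E2 * ψ (m2 i)]) → φ T0 * ψ T1 = φ T1 * ψ T0

/-- Each coordinate `x j` is divisible by the two exceptional sections over the coordinate points on
the line `x j = 0`; the quotient is `s j`. An exceptional section may be identically zero, so
quotients are obtained from Bézout identities and not by cancellation. -/
theorem HasCurve.exists_isToricCurve {κ : Type} {Q : κ → Fin 3 → ℂ} {d a0 a1 a2 : ℤ} {b : κ → ℤ}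
    (hQ : ∀ i j, Q i j ≠ 0)
    (h : HasCurve (Sum.elim coordPt Q) d (Sum.elim ![a0, a1, a2] b)) :
    ∃ E0 E1 E2 s0 s1 s2 e m0 m1 m2,
      IsToricCurve Q d ![a0, a1, a2] b E0 E1 E2 s0 s1 s2 e m0 m1 m2 := by
  obtain ⟨x, e, l, H⟩ := h
  obtain ⟨E0, hE0⟩ : ∃ E, E = e (.inl 0) := ⟨_, rfl⟩
  obtain ⟨E1, hE1⟩ : ∃ E, E = e (.inl 1) := ⟨_, rfl⟩
  obtain ⟨E2, hE2⟩ : ∃ E, E = e (.inl 2) := ⟨_, rfl⟩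
  have dE0 : HasDeg a0 E0 := by simpa [hE0] using H.deg_e (.inl 0)
  have dE1 : HasDeg a1 E1 := by simpa [hE1] using H.deg_e (.inl 1)
  have dE2 : HasDeg a2 E2 := by simpa [hE2] using H.deg_e (.inl 2)
  have dl0 : ∀ j, HasDeg (d - a0) (l (.inl 0) j) := by simpa using H.deg_l (.inl 0)
  have dl1 : ∀ j, HasDeg (d - a1) (l (.inl 1) j) := by simpa using H.deg_l (.inl 1)
  have dl2 : ∀ j, HasDeg (d - a2) (l (.inl 2) j) := by simpa using H.deg_l (.inl 2)
  have q01 : -x 2 = E0 * l (.inl 0) 1 := by simpa [coordPt, hE0] using H.cross1 (.inl 0)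
  have q02 : x 1 = E0 * l (.inl 0) 2 := by simpa [coordPt, hE0] using H.cross2 (.inl 0)
  have q10 : x 2 = E1 * l (.inl 1) 0 := by simpa [coordPt, hE1] using H.cross0 (.inl 1)
  have q12 : -x 0 = E1 * l (.inl 1) 2 := by simpa [coordPt, hE1] using H.cross2 (.inl 1)
  have q20 : -x 1 = E2 * l (.inl 2) 0 := by simpa [coordPt, hE2] using H.cross0 (.inl 2)
  have q21 : x 0 = E2 * l (.inl 2) 1 := by simpa [coordPt, hE2] using H.cross1 (.inl 2)
  have z0 : l (.inl 0) 0 = 0 := by simpa [coordPt] using H.incid_pt (.inl 0)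
  have z1 : l (.inl 1) 1 = 0 := by simpa [coordPt] using H.incid_pt (.inl 1)
  have z2 : l (.inl 2) 2 = 0 := by simpa [coordPt] using H.incid_pt (.inl 2)
  have cop01 : IsCoprime E0 E1 := isCoprime_of_forall_field fun K _ φ h0 h1 => by
    apply H.x_ne K φ
    · rw [← neg_eq_zero, ← map_neg, q12, map_mul, h1, zero_mul]
    · rw [q02, map_mul, h0, zero_mul]
    · rw [q10, map_mul, h1, zero_mul]
  have cop02 : IsCoprime E0 E2 := isCoprime_of_forall_field fun K _ φ h0 h1 => by
    apply H.x_ne K φ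
    · rw [q21, map_mul, h1, zero_mul]
    · rw [q02, map_mul, h0, zero_mul]
    · rw [← neg_eq_zero, ← map_neg, q01, map_mul, h0, zero_mul]
  have cop12 : IsCoprime E1 E2 := isCoprime_of_forall_field fun K _ φ h0 h1 => by
    apply H.x_ne K φ
    · rw [q21, map_mul, h1, zero_mul]
    · rw [← neg_eq_zero, ← map_neg, q20, map_mul, h1, zero_mul]
    · rw [q10, map_mul, h0, zero_mul]
  -- Comparing two factorizations of the same coordinate yields the pull-back of the line through
  -- two coordinate points.
  obtain ⟨s2, l01, l10⟩ := cop01.exists_common_cofactor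
    (show E0 * -l (.inl 0) 1 = E1 * l (.inl 1) 0 by linear_combination q01 + q10)
  obtain ⟨s1, l02, l20⟩ := cop02.exists_common_cofactor
    (show E0 * l (.inl 0) 2 = E2 * -l (.inl 2) 0 by linear_combination -q02 - q20)
  obtain ⟨s0, l12, l21⟩ := cop12.exists_common_cofactor
    (show E1 * -l (.inl 1) 2 = E2 * l (.inl 2) 1 by linear_combination q12 + q21)
  rw [neg_eq_iff_eq_neg] at l01 l20 l12
  have X0 : x 0 = E1 * E2 * s0 := by rw [q21, l21]; ring
  have X1 : x 1 = E0 * E2 * s1 := by rw [q02, l02]; ring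
  have X2 : x 2 = E0 * E1 * s2 := by rw [q10, l10]; ring
  have ds0 : HasDeg (d - a1 - a2) s0 := by
    refine HasDeg.of_mul_coprime dE1 dE2 cop12 ?_ ?_
    · convert dl2 1 using 1
      · ring
      · exact l21.symm
    · convert (dl1 2).neg using 1
      · ring
      · rw [l12, neg_neg]
  have ds1 : HasDeg (d - a0 - a2) s1 := by
    refine HasDeg.of_mul_coprime dE0 dE2 cop02 ?_ ?_
    · convert (dl2 0).neg using 1
      · ring
      · rw [l20, neg_neg]
    · convert (dl0 2) using 1
      · ring
      · exact l02.symm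
  have ds2 : HasDeg (d - a0 - a1) s2 := by
    refine HasDeg.of_mul_coprime dE0 dE1 cop01 ?_ ?_
    · convert (dl1 0) using 1
      · ring
      · exact l10.symm
    · convert (dl0 1).neg using 1
      · ring
      · rw [l01, neg_neg]
  have c0 : ∀ i, const (Q i 1) * x 2 - const (Q i 2) * x 1 = e (.inr i) * l (.inr i) 0 :=
    fun i => H.cross0 (.inr i)
  have c1 : ∀ i, const (Q i 2) * x 0 - const (Q i 0) * x 2 = e (.inr i) * l (.inr i) 1 :=
    fun i => H.cross1 (.inr i)
  have c2 : ∀ i, const (Q i 0) * x 1 - const (Q i 1) * x 0 = e (.inr i) * l (.inr i) 2 :=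
    fun i => H.cross2 (.inr i)
  have xne : ∀ i (K : Type) [Field K] (φ : BiPoly →+* K), φ (e (.inr i)) = 0 →
      φ (x 0) ≠ 0 ∧ φ (x 1) ≠ 0 ∧ φ (x 2) ≠ 0 := by
    intro i K _ φ he
    have := H.x_ne_zero_of_e_eq_zero (i := .inr i) (hQ i) φ he
    exact ⟨this 0, this 1, this 2⟩
  -- Where `e` vanishes the curve sits over `Q i`, off the coordinate lines, whereas each `E j`
  -- divides two of the coordinates of `x`.
  have cope0 : ∀ i, IsCoprime (e (.inr i)) E0 := fun i =>
    isCoprime_of_forall_field fun K _ φ h0 h1 => (xne i K φ h0).2.1 (by simp [X1, h1])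
  have cope1 : ∀ i, IsCoprime (e (.inr i)) E1 := fun i =>
    isCoprime_of_forall_field fun K _ φ h0 h1 => (xne i K φ h0).1 (by simp [X0, h1])
  have cope2 : ∀ i, IsCoprime (e (.inr i)) E2 := fun i =>
    isCoprime_of_forall_field fun K _ φ h0 h1 => (xne i K φ h0).1 (by simp [X0, h1])
  choose m0 L0 w0 using fun i => (cope0 i).exists_common_cofactor
    (show e (.inr i) * l (.inr i) 0 = E0 * (const (Q i 1) * E1 * s2 - const (Q i 2) * E2 * s1) by
      rw [← c0, X1, X2]; ring)
  choose m1 L1 w1 using fun i => (cope1 i).exists_common_cofactor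
    (show e (.inr i) * l (.inr i) 1 = E1 * (const (Q i 2) * E2 * s0 - const (Q i 0) * E0 * s2) by
      rw [← c1, X0, X2]; ring)
  choose m2 L2 w2 using fun i => (cope2 i).exists_common_cofactor
    (show e (.inr i) * l (.inr i) 2 = E2 * (const (Q i 0) * E0 * s1 - const (Q i 1) * E1 * s0) by
      rw [← c2, X0, X1]; ring)
  have ms : ∀ i, s0 * m0 i + s1 * m1 i + s2 * m2 i = 0 := by
    intro i
    -- Neither `e` nor `E0 * E1 * E2` can be cancelled, but both annihilate the sum and they are
    -- coprime.
    obtain ⟨u, v, huv⟩ := ((cope0 i).mul_right (cope1 i)).mul_right (cope2 i)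
    have hi := H.incid (.inr i)
    rw [L0, L1, L2, X0, X1, X2] at hi
    linear_combination (-(s0 * m0 i + s1 * m1 i + s2 * m2 i)) * huv + v * hi -
      u * s0 * w0 i - u * s1 * w1 i - u * s2 * w2 i
  have mp : ∀ i, E0 * m0 i * const (Q i 0) + E1 * m1 i * const (Q i 1) +
      E2 * m2 i * const (Q i 2) = 0 := by
    intro i
    have hi := H.incid_pt (.inr i)
    rw [L0, L1, L2] at hi
    exact hi
  have dm0 : ∀ i, HasDeg (d - b i - a0) (m0 i) := by
    intro i
    refine HasDeg.of_mul_coprime (H.deg_e (.inr i)) dE0 (cope0 i) ?_ ?_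
    · rw [← w0, mul_assoc, mul_assoc]
      refine (HasDeg.const_mul _ ?_).sub (HasDeg.const_mul _ ?_)
      · exact dE1.mul ds2 (by simp; ring)
      · exact dE2.mul ds1 (by simp; ring)
    · rw [← L0]
      convert H.deg_l (.inr i) 0 using 1
      simp
  have dm1 : ∀ i, HasDeg (d - b i - a1) (m1 i) := by
    intro i
    refine HasDeg.of_mul_coprime (H.deg_e (.inr i)) dE1 (cope1 i) ?_ ?_
    · rw [← w1, mul_assoc, mul_assoc]
      refine (HasDeg.const_mul _ ?_).sub (HasDeg.const_mul _ ?_)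
      · exact dE2.mul ds0 (by simp; ring)
      · exact dE0.mul ds2 (by simp; ring)
    · rw [← L1]
      convert H.deg_l (.inr i) 1 using 1
      simp
  have dm2 : ∀ i, HasDeg (d - b i - a2) (m2 i) := by
    intro i
    refine HasDeg.of_mul_coprime (H.deg_e (.inr i)) dE2 (cope2 i) ?_ ?_
    · rw [← w2, mul_assoc, mul_assoc]
      refine (HasDeg.const_mul _ ?_).sub (HasDeg.const_mul _ ?_)
      · exact dE0.mul ds1 (by simp; ring)
      · exact dE1.mul ds0 (by simp; ring)
    · rw [← L2]
      convert H.deg_l (.inr i) 2 using 1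
      simp
  refine ⟨E0, E1, E2, s0, s1, s2, e ∘ .inr, m0, m1, m2, dE0, dE1, dE2, ds0, ds1, ds2,
    fun i => H.deg_e (.inr i), dm0, dm1, dm2, w0, w1, w2, ms, mp, ?_, ?_, ?_, ?_, ?_, ?_⟩
  · intro K _ φ h1 h2
    apply H.l_ne (.inl 0) K φ <;> simp [z0, l01, l02, h1, h2]
  · intro K _ φ h1 h2
    apply H.l_ne (.inl 1) K φ <;> simp [z1, l12, l10, h1, h2]
  · intro K _ φ h1 h2
    apply H.l_ne (.inl 2) K φ <;> simp [z2, l20, l21, h1, h2]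
  · intro K _ φ h0 h1 h2
    apply H.x_ne K φ <;> simp only [X0, X1, X2, map_mul, h0, h1, h2]
  · intro i K _ φ h0 h1 h2
    apply H.l_ne (.inr i) K φ <;> simp only [L0, L1, L2, map_mul, h0, h1, h2]
  · intro R _ _ _ φ ψ h0 h1 h2 h
    apply H.sep R φ ψ
    · rw [par_iff]
      simp only [X0, X1, X2, map_mul]
      refine ⟨?_, ?_, ?_⟩
      · linear_combination (-φ E2 * ψ E2) * h2
      · linear_combination (-φ E1 * ψ E1) * h1
      · linear_combination (-φ E0 * ψ E0) * h0
    · rintro (i | i)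
      · rw [par_iff]
        fin_cases i
        · simp [z0, l01, l02]
          linear_combination h0
        · simp [z1, l12, l10]
          linear_combination h1
        · simp [z2, l20, l21]
          linear_combination h2
      · have := h i
        rw [par_iff] at this ⊢
        simpa [L0, L1, L2] using this

/-! ### The transformed curve in toric coordinates -/

namespace IsToricCurve

variable {κ : Type} {Q : κ → Fin 3 → ℂ} {d : ℤ} {a : Fin 3 → ℤ} {b : κ → ℤ}
  {E0 E1 E2 s0 s1 s2 : BiPoly} {e m0 m1 m2 : κ → BiPoly}

/-- Where `e i` vanishes, `w0`, `w1`, `w2` make the two entries of each pair proportional with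
nonzero factors, and by `ne0`, `ne1`, `ne2` they are not both zero. -/
theorem ne_zero_of_e_eq_zero (H : IsToricCurve Q d a b E0 E1 E2 s0 s1 s2 e m0 m1 m2) {i : κ}
    (hQ : ∀ j, Q i j ≠ 0) {K : Type} [Field K] (φ : BiPoly →+* K) (he : φ (e i) = 0) :
    (φ E1 * φ s2 ≠ 0 ∧ φ E2 * φ s1 ≠ 0) ∧ (φ E2 * φ s0 ≠ 0 ∧ φ E0 * φ s2 ≠ 0) ∧
      φ E0 * φ s1 ≠ 0 ∧ φ E1 * φ s0 ≠ 0 := by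
  have key : ∀ {u v p q : K}, u ≠ 0 → v ≠ 0 → (p = 0 → q = 0 → False) → u * p - v * q = 0 →
      p ≠ 0 ∧ q ≠ 0 := by
    intro u v p q hu hv hpq h
    refine ⟨fun hp => hpq hp ?_, fun hq => hpq ?_ hq⟩
    · simpa [hp, hv] using h
    · simpa [hq, hu] using h
  have n := fun j => map_const_ne_zero φ (hQ j)
  have h0 := congrArg φ (H.w0 i)
  have h1 := congrArg φ (H.w1 i)
  have h2 := congrArg φ (H.w2 i)
  simp only [map_sub, map_mul, he, zero_mul, mul_assoc] at h0 h1 h2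
  exact ⟨key (n 1) (n 2) (H.ne0 K φ) h0, key (n 2) (n 0) (fun h h' => H.ne1 K φ h' h) h1,
    key (n 0) (n 1) (H.ne2 K φ) h2⟩

/-- A curve is determined by its image under the Cremona transformation, in local rings. -/
theorem par_of_par (H : IsToricCurve Q d a b E0 E1 E2 s0 s1 s2 e m0 m1 m2) {i : κ}
    (hQ : ∀ j, Q i j ≠ 0) {R : Type} [CommRing R] [Algebra ℂ R] [IsLocalRing R]
    (φ ψ : BiPoly →ₐ[ℂ] R)
    (h0 : φ E1 * φ s2 * (ψ E2 * ψ s1) = φ E2 * φ s1 * (ψ E1 * ψ s2))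
    (h1 : φ E0 * φ s2 * (ψ E2 * ψ s0) = φ E2 * φ s0 * (ψ E0 * ψ s2))
    (h2 : φ E0 * φ s1 * (ψ E1 * ψ s0) = φ E1 * φ s0 * (ψ E0 * ψ s1))
    (h : Par ![φ s0 * φ (m0 i), φ s1 * φ (m1 i), φ s2 * φ (m2 i)]
      ![ψ s0 * ψ (m0 i), ψ s1 * ψ (m1 i), ψ s2 * ψ (m2 i)]) :
    Par ![φ E0 * φ (m0 i), φ E1 * φ (m1 i), φ E2 * φ (m2 i)]
      ![ψ E0 * ψ (m0 i), ψ E1 * ψ (m1 i), ψ E2 * ψ (m2 i)] := by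
  rw [par_iff] at h ⊢
  simp only [Matrix.cons_val] at h ⊢
  obtain ⟨g2, g1, g0⟩ := h
  -- If `e i` is a unit at both points, the line component is a cross product with `x` divided by `e
  -- i`, hence determined by `x`. Otherwise one of the points reduces to one over `Q i`, off the
  -- coordinate lines; `h0`, `h1`, `h2` transfer this to the other point, so all `E j` and `s j` are
  -- units and can be cancelled.
  by_cases he : IsUnit (φ (e i) * ψ (e i))
  · have w0 := congrArg φ (H.w0 i)
    have w1 := congrArg φ (H.w1 i)
    have w2 := congrArg φ (H.w2 i)
    have v0 := congrArg ψ (H.w0 i)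
    have v1 := congrArg ψ (H.w1 i)
    have v2 := congrArg ψ (H.w2 i)
    simp only [map_sub, map_mul, algHom_const] at w0 w1 w2 v0 v1 v2
    set t0 := algebraMap ℂ R (Q i 0)
    set t1 := algebraMap ℂ R (Q i 1)
    set t2 := algebraMap ℂ R (Q i 2)
    refine ⟨he.mul_left_cancel ?_, he.mul_left_cancel ?_, he.mul_left_cancel ?_⟩
    · linear_combination (-(φ E0 * ψ E1 * ψ (e i) * ψ (m1 i))) * w0 -
        φ E0 * ψ E1 * (t1 * φ E1 * φ s2 - t2 * φ E2 * φ s1) * v1 +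
        φ E1 * ψ E0 * ψ (e i) * ψ (m0 i) * w1 +
        φ E1 * ψ E0 * (t2 * φ E2 * φ s0 - t0 * φ E0 * φ s2) * v0 -
        t2 * (t0 * φ E0 * ψ E0 * h0 - t1 * φ E1 * ψ E1 * h1 + t2 * φ E2 * ψ E2 * h2)
    · linear_combination (-(φ E0 * ψ E2 * ψ (e i) * ψ (m2 i))) * w0 -
        φ E0 * ψ E2 * (t1 * φ E1 * φ s2 - t2 * φ E2 * φ s1) * v2 +
        φ E2 * ψ E0 * ψ (e i) * ψ (m0 i) * w2 +
        φ E2 * ψ E0 * (t0 * φ E0 * φ s1 - t1 * φ E1 * φ s0) * v0 +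
        t1 * (t0 * φ E0 * ψ E0 * h0 - t1 * φ E1 * ψ E1 * h1 + t2 * φ E2 * ψ E2 * h2)
    · linear_combination (-(φ E1 * ψ E2 * ψ (e i) * ψ (m2 i))) * w1 -
        φ E1 * ψ E2 * (t2 * φ E2 * φ s0 - t0 * φ E0 * φ s2) * v2 +
        φ E2 * ψ E1 * ψ (e i) * ψ (m1 i) * w2 +
        φ E2 * ψ E1 * (t0 * φ E0 * φ s1 - t1 * φ E1 * φ s0) * v1 -
        t0 * (t0 * φ E0 * ψ E0 * h0 - t1 * φ E1 * ψ E1 * h1 + t2 * φ E2 * ψ E2 * h2)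
  · have units : (IsUnit (φ E1 * φ s2) ∧ IsUnit (φ E2 * φ s1)) ∧
        (IsUnit (φ E2 * φ s0) ∧ IsUnit (φ E0 * φ s2)) ∧
        IsUnit (φ E0 * φ s1) ∧ IsUnit (φ E1 * φ s0) ∧
        (IsUnit (ψ E1 * ψ s2) ∧ IsUnit (ψ E2 * ψ s1)) ∧
        (IsUnit (ψ E2 * ψ s0) ∧ IsUnit (ψ E0 * ψ s2)) ∧
        IsUnit (ψ E0 * ψ s1) ∧ IsUnit (ψ E1 * ψ s0) := by
      let Φ : BiPoly →+* IsLocalRing.ResidueField R := (IsLocalRing.residue R).comp φ.toRingHom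
      let Ψ : BiPoly →+* IsLocalRing.ResidueField R := (IsLocalRing.residue R).comp ψ.toRingHom
      have key : ∀ {p q p' q' : IsLocalRing.ResidueField R}, p ≠ 0 ∧ q ≠ 0 → p * q' = q * p' →
          (p' = 0 → q' = 0 → False) → p' ≠ 0 ∧ q' ≠ 0 := by
        intro p q p' q' hp h hn
        refine ⟨fun h' => hn h' ?_, fun h' => hn ?_ h'⟩
        · simpa [h', hp.1] using h
        · simpa [h', hp.2] using h
      have H0 := congrArg (IsLocalRing.residue R) h0
      have H1 := congrArg (IsLocalRing.residue R) h1
      have H2 := congrArg (IsLocalRing.residue R) h2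
      rw [IsUnit.mul_iff, not_and_or] at he
      simp only [← IsLocalRing.residue_ne_zero_iff_isUnit, not_not, map_mul] at he H0 H1 H2 ⊢
      rcases he with he | he
      · obtain ⟨k0, k1, k2⟩ := H.ne_zero_of_e_eq_zero hQ Φ he
        exact ⟨k0, k1, k2.1, k2.2, key k0 H0 (H.ne0 _ Ψ),
          (key k1.symm H1 (H.ne1 _ Ψ)).symm, key k2 H2 (H.ne2 _ Ψ)⟩
      · obtain ⟨k0, k1, k2⟩ := H.ne_zero_of_e_eq_zero hQ Ψ he
        have k0' := key k0 (by linear_combination -H0) (H.ne0 _ Φ)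
        have k1' := key k1.symm (by linear_combination -H1) (H.ne1 _ Φ)
        have k2' := key k2 (by linear_combination -H2) (H.ne2 _ Φ)
        exact ⟨k0', k1'.symm, k2'.1, k2'.2, k0, k1, k2⟩
    simp only [IsUnit.mul_iff] at units
    obtain ⟨⟨⟨_, u2⟩, ⟨_, u1⟩⟩, _, _, _, ⟨_, _⟩, ⟨⟨_, U0⟩, _⟩, ⟨_, U1⟩, _⟩ := units
    refine ⟨(u1.mul U0).mul_left_cancel ?_, (u2.mul U0).mul_left_cancel ?_,
      (u2.mul U1).mul_left_cancel ?_⟩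
    · linear_combination φ (m0 i) * ψ (m1 i) * h2 + φ E1 * ψ E0 * g2
    · linear_combination φ (m0 i) * ψ (m2 i) * h1 + φ E2 * ψ E0 * g1
    · linear_combination φ (m1 i) * ψ (m2 i) * h0 + φ E2 * ψ E1 * g0

set_option maxHeartbeats 1000000 in
/-- The curve after the Cremona transformation. -/
theorem hasCurve (H : IsToricCurve Q d a b E0 E1 E2 s0 s1 s2 e m0 m1 m2) (hQ : ∀ i j, Q i j ≠ 0) :
    HasCurve (Sum.elim coordPt fun i j => (Q i j)⁻¹) (2 * d - a 0 - a 1 - a 2)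
      (Sum.elim ![d - a 1 - a 2, d - a 0 - a 2, d - a 0 - a 1] b) := by
  have cinv : ∀ i j, const (Q i j)⁻¹ * const (Q i j) = 1 := by
    intro i j
    rw [← map_mul, inv_mul_cancel₀ (hQ i j), map_one]
  obtain ⟨x, hx⟩ : ∃ x : Fin 3 → BiPoly, x = ![s1 * s2 * E0, s0 * s2 * E1, s0 * s1 * E2] :=
    ⟨_, rfl⟩
  obtain ⟨l, hl⟩ : ∃ l : Fin 3 → Fin 3 → BiPoly, l = ![![0, -(s1 * E2), s2 * E1],
    ![s0 * E2, 0, -(s2 * E0)], ![-(s0 * E1), s1 * E0, 0]] := ⟨_, rfl⟩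
  obtain ⟨n, hn⟩ : ∃ n : κ → Fin 3 → BiPoly, n = fun i =>
    ![-(const (Q i 1)⁻¹ * (const (Q i 2)⁻¹ * (s0 * m0 i))),
      -(const (Q i 2)⁻¹ * (const (Q i 0)⁻¹ * (s1 * m1 i))),
      -(const (Q i 0)⁻¹ * (const (Q i 1)⁻¹ * (s2 * m2 i)))] := ⟨_, rfl⟩
  have x0 : x 0 = s1 * s2 * E0 := by rw [hx]; rfl
  have x1 : x 1 = s0 * s2 * E1 := by rw [hx]; rfl
  have x2 : x 2 = s0 * s1 * E2 := by rw [hx]; rfl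
  have n0 : ∀ i, n i 0 = -(const (Q i 1)⁻¹ * (const (Q i 2)⁻¹ * (s0 * m0 i))) := by
    intro i; rw [hn]; rfl
  have n1 : ∀ i, n i 1 = -(const (Q i 2)⁻¹ * (const (Q i 0)⁻¹ * (s1 * m1 i))) := by
    intro i; rw [hn]; rfl
  have n2 : ∀ i, n i 2 = -(const (Q i 0)⁻¹ * (const (Q i 1)⁻¹ * (s2 * m2 i))) := by
    intro i; rw [hn]; rfl
  have i3 : ∀ {p : Fin 3 → Prop}, p 0 → p 1 → p 2 → ∀ j, p j := by
    intro p h0 h1 h2 j; fin_cases j <;> assumption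
  have nex' : ∀ (K : Type) [Field K] (φ : BiPoly →+* K), φ s1 * φ s2 * φ E0 = 0 →
      φ s0 * φ s2 * φ E1 = 0 → φ s0 * φ s1 * φ E2 = 0 → False := by
    intro K _ φ
    have := H.ne0 K φ
    have := H.ne1 K φ
    have := H.ne2 K φ
    have := H.nex K φ
    simp only [mul_eq_zero] at *
    tauto
  refine ⟨x, Sum.elim ![s0, s1, s2] e, Sum.elim l n, ?_, ?_, ?_, ?_, ?_, ?_, ?_, ?_,
      ?_, ?_, ?_⟩
  · refine i3 ?_ ?_ ?_
    · rw [x0]; exact (H.ds1.mul H.ds2 rfl).mul H.dE0 (by ring)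
    · rw [x1]; exact (H.ds0.mul H.ds2 rfl).mul H.dE1 (by ring)
    · rw [x2]; exact (H.ds0.mul H.ds1 rfl).mul H.dE2 (by ring)
  · rintro (i | i)
    · revert i
      exact i3 H.ds0 H.ds1 H.ds2
    · exact H.de i
  · rintro (i | i)
    · revert i
      simp only [Sum.elim_inl]
      refine i3 (i3 ?_ ?_ ?_) (i3 ?_ ?_ ?_) (i3 ?_ ?_ ?_) <;>
        simp only [hl, Matrix.cons_val]
      · exact hasDeg_zero _
      · exact (H.ds1.mul H.dE2 (by ring)).neg
      · exact H.ds2.mul H.dE1 (by ring)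
      · exact H.ds0.mul H.dE2 (by ring)
      · exact hasDeg_zero _
      · exact (H.ds2.mul H.dE0 (by ring)).neg
      · exact (H.ds0.mul H.dE1 (by ring)).neg
      · exact H.ds1.mul H.dE0 (by ring)
      · exact hasDeg_zero _
    · simp only [Sum.elim_inr]
      refine i3 ?_ ?_ ?_
      · rw [n0]
        exact (((H.ds0.mul (H.dm0 i) (by ring)).const_mul _).const_mul _).neg
      · rw [n1]
        exact (((H.ds1.mul (H.dm1 i) (by ring)).const_mul _).const_mul _).neg
      · rw [n2]
        exact (((H.ds2.mul (H.dm2 i) (by ring)).const_mul _).const_mul _).neg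
  · rintro (i | i)
    · fin_cases i <;> simp [coordPt, hl, x1, x2] <;> ring
    · simp only [Sum.elim_inr, n0, x1, x2]
      linear_combination (-(const (Q i 1)⁻¹ * const (Q i 2)⁻¹ * s0)) * H.w0 i +
        const (Q i 2)⁻¹ * s0 * s2 * E1 * cinv i 1 - const (Q i 1)⁻¹ * s0 * s1 * E2 * cinv i 2
  · rintro (i | i)
    · fin_cases i <;> simp [coordPt, hl, x0, x2] <;> ring
    · simp only [Sum.elim_inr, n1, x0, x2]
      linear_combination (-(const (Q i 2)⁻¹ * const (Q i 0)⁻¹ * s1)) * H.w1 i +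
        const (Q i 0)⁻¹ * s0 * s1 * E2 * cinv i 2 - const (Q i 2)⁻¹ * s1 * s2 * E0 * cinv i 0
  · rintro (i | i)
    · fin_cases i <;> simp [coordPt, hl, x0, x1] <;> ring
    · simp only [Sum.elim_inr, n2, x0, x1]
      linear_combination (-(const (Q i 0)⁻¹ * const (Q i 1)⁻¹ * s2)) * H.w2 i +
        const (Q i 1)⁻¹ * s1 * s2 * E0 * cinv i 0 - const (Q i 0)⁻¹ * s0 * s2 * E1 * cinv i 1
  · rintro (i | i)
    · fin_cases i <;> simp [coordPt, hl]
    · simp only [Sum.elim_inr, n0, n1, n2]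
      linear_combination (-(const (Q i 0)⁻¹ * const (Q i 1)⁻¹ * const (Q i 2)⁻¹)) * H.ms i
  · rintro (i | i)
    · fin_cases i <;> simp [hl, x0, x1, x2] <;> ring
    · simp only [Sum.elim_inr, n0, n1, n2, x0, x1, x2]
      linear_combination (-(s0 * s1 * s2 * const (Q i 0)⁻¹ * const (Q i 1)⁻¹ *
          const (Q i 2)⁻¹)) * H.mp i +
        s0 * s1 * s2 * (const (Q i 1)⁻¹ * const (Q i 2)⁻¹ * m0 i * E0 * cinv i 0 +
          const (Q i 2)⁻¹ * const (Q i 0)⁻¹ * m1 i * E1 * cinv i 1 +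
          const (Q i 0)⁻¹ * const (Q i 1)⁻¹ * m2 i * E2 * cinv i 2)
  · simpa only [x0, x1, x2, map_mul] using nex'
  · rintro (i | i) K _ φ
    · have k0 := H.ne0 K φ
      have k1 := H.ne1 K φ
      have k2 := H.ne2 K φ
      simp only [mul_eq_zero] at k0 k1 k2
      fin_cases i <;> simp [hl] <;> tauto
    · have nq := fun j => map_const_ne_zero φ (inv_ne_zero (hQ i j))
      have nQ := fun j => map_const_ne_zero φ (hQ i j)
      simp only [Sum.elim_inr, n0, n1, n2, map_neg, map_mul, neg_eq_zero, mul_eq_zero, nq,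
        false_or]
      intro k0 k1 k2
      -- If no `s j` vanishes, all `m j` do, against `nel`. If some `s j` vanishes, then `e i` does
      -- not, so the new `x` is parallel to the inverse of `Q i`, which has no zero coordinate; as
      -- some coordinate of `x` vanishes, all do, against `nex'`.
      by_cases hs : φ s0 ≠ 0 ∧ φ s1 ≠ 0 ∧ φ s2 ≠ 0
      · obtain ⟨h0, h1, h2⟩ := hs
        simp only [h0, h1, h2, false_or] at k0 k1 k2
        apply H.nel i K φ <;> simp [k0, k1, k2]
      · have he : φ (e i) ≠ 0 := by
          intro he
          obtain ⟨⟨h1, h2⟩, ⟨h3, h4⟩, h5, h6⟩ := H.ne_zero_of_e_eq_zero (hQ i) φ he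
          simp only [mul_ne_zero_iff] at *
          tauto
        have w0 := congrArg φ (H.w0 i)
        have w1 := congrArg φ (H.w1 i)
        have w2 := congrArg φ (H.w2 i)
        simp only [map_mul, map_sub] at w0 w1 w2
        rw [← mul_eq_zero] at k0 k1 k2
        have r0 : φ s0 * (φ (const (Q i 1)) * φ E1 * φ s2 - φ (const (Q i 2)) * φ E2 * φ s1) = 0 := by
          rw [w0]; linear_combination φ (e i) * k0
        have r1 : φ s1 * (φ (const (Q i 2)) * φ E2 * φ s0 - φ (const (Q i 0)) * φ E0 * φ s2) = 0 := by
          rw [w1]; linear_combination φ (e i) * k1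
        have r2 : φ s2 * (φ (const (Q i 0)) * φ E0 * φ s1 - φ (const (Q i 1)) * φ E1 * φ s0) = 0 := by
          rw [w2]; linear_combination φ (e i) * k2
        by_cases z0 : φ s0 = 0
        · refine nex' K φ ((mul_eq_zero_iff_left (nQ 0)).1 ?_) (by simp [z0]) (by simp [z0])
          linear_combination -r1 + φ s1 * φ (const (Q i 2)) * φ E2 * z0
        by_cases z1 : φ s1 = 0
        · refine nex' K φ (by simp [z1]) ((mul_eq_zero_iff_left (nQ 1)).1 ?_) (by simp [z1])
          linear_combination r0 + φ s0 * φ (const (Q i 2)) * φ E2 * z1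
        by_cases z2 : φ s2 = 0
        · refine nex' K φ (by simp [z2]) (by simp [z2]) ((mul_eq_zero_iff_left (nQ 2)).1 ?_)
          linear_combination -r0 + φ s0 * φ (const (Q i 1)) * φ E1 * z2
        exact hs ⟨z0, z1, z2⟩
  -- The pencils of lines through the coordinate points are preserved: `h0`, `h1`, `h2` are
  -- symmetric under exchanging the `E j` with the `s j`. So the components over these points
  -- already determine the old ones.
  · intro R _ _ _ φ ψ _ hp
    have p0 := (par_iff.1 (hp (.inl 0))).2.2
    have p1 := (par_iff.1 (hp (.inl 1))).2.1
    have p2 := (par_iff.1 (hp (.inl 2))).1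
    simp only [hl, Sum.elim_inl, Matrix.cons_val, map_neg, map_mul] at p0 p1 p2
    have h0 : φ E1 * φ s2 * (ψ E2 * ψ s1) = φ E2 * φ s1 * (ψ E1 * ψ s2) := by
      linear_combination p0
    have h1 : φ E0 * φ s2 * (ψ E2 * ψ s0) = φ E2 * φ s0 * (ψ E0 * ψ s2) := by
      linear_combination p1
    have h2 : φ E0 * φ s1 * (ψ E1 * ψ s0) = φ E1 * φ s0 * (ψ E0 * ψ s1) := by
      linear_combination p2
    refine H.sep R φ ψ h0 h1 h2 fun i => H.par_of_par (hQ i) φ ψ h0 h1 h2 ?_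
    have q := par_iff.1 (hp (.inr i))
    simp only [Sum.elim_inr, n0, n1, n2, map_neg, map_mul, algHom_const] at q
    have u : ∀ j, IsUnit (algebraMap ℂ R (Q i j)⁻¹) := fun j =>
      (inv_ne_zero (hQ i j)).isUnit.map _
    rw [par_iff]
    simp only [Matrix.cons_val]
    obtain ⟨q2, q1, q0⟩ := q
    refine ⟨(((u 0).mul (u 1)).mul ((u 2).mul (u 2))).mul_left_cancel ?_,
      (((u 0).mul (u 2)).mul ((u 1).mul (u 1))).mul_left_cancel ?_,
      (((u 1).mul (u 2)).mul ((u 0).mul (u 0))).mul_left_cancel ?_⟩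
    · linear_combination q2
    · linear_combination q1
    · linear_combination q0

end IsToricCurve

/-- A curve after the quadratic Cremona transformation based at the coordinate points. -/
theorem HasCurve.cremona_coordPt {κ : Type} {Q : κ → Fin 3 → ℂ} {d a0 a1 a2 : ℤ} {b : κ → ℤ}
    (hQ : ∀ i j, Q i j ≠ 0)
    (h : HasCurve (Sum.elim coordPt Q) d (Sum.elim ![a0, a1, a2] b)) :
    HasCurve (Sum.elim coordPt fun i j => (Q i j)⁻¹) (2 * d - a0 - a1 - a2)
      (Sum.elim ![d - a1 - a2, d - a0 - a2, d - a0 - a1] b) := by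
  obtain ⟨E0, E1, E2, s0, s1, s2, e, m0, m1, m2, H⟩ := h.exists_isToricCurve hQ
  exact H.hasCurve hQ

/-- The exceptional divisor over a point. -/
theorem HasCurve.exceptionalDivisor {κ : Type} {p : Fin 3 → ℂ} {Q : κ → Fin 3 → ℂ}
    (hp : p 0 ≠ 0) (hQ : ∀ i, p 0 * Q i 1 ≠ p 1 * Q i 0) :
    HasCurve (Sum.elim (fun _ : Unit => p) Q) 0 (Sum.elim (fun _ => -1) fun _ => 0) := by
  have cp := fun (K : Type) [Field K] (φ : BiPoly →+* K) => map_const_ne_zero φ hp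
  have cq := fun i (K : Type) [Field K] (φ : BiPoly →+* K) =>
    map_const_ne_zero φ (sub_ne_zero.2 (hQ i))
  -- The pencil of lines through `p`, solved for the first coefficient; the curve stays at `p` and
  -- is parametrized by this pencil.
  obtain ⟨l, hl⟩ : ∃ l : Fin 3 → BiPoly, l = ![-(const (p 1) * T0 + const (p 2) * T1),
    const (p 0) * T0, const (p 0) * T1] := ⟨_, rfl⟩
  obtain ⟨n, hn⟩ : ∃ n : κ → Fin 3 → ℂ, n = fun i => ![Q i 1 * p 2 - Q i 2 * p 1,
    Q i 2 * p 0 - Q i 0 * p 2, Q i 0 * p 1 - Q i 1 * p 0] := ⟨_, rfl⟩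
  have l0 : l 0 = -(const (p 1) * T0 + const (p 2) * T1) := by rw [hl]; rfl
  have l1 : l 1 = const (p 0) * T0 := by rw [hl]; rfl
  have l2 : l 2 = const (p 0) * T1 := by rw [hl]; rfl
  have n0 : ∀ i, n i 0 = Q i 1 * p 2 - Q i 2 * p 1 := by intro i; rw [hn]; rfl
  have n1 : ∀ i, n i 1 = Q i 2 * p 0 - Q i 0 * p 2 := by intro i; rw [hn]; rfl
  have n2 : ∀ i, n i 2 = Q i 0 * p 1 - Q i 1 * p 0 := by intro i; rw [hn]; rfl
  have hT : ∀ (K : Type) [Field K] (φ : BiPoly →+* K), φ T0 = 0 → φ T1 = 0 → False := by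
    intro K _ φ h0 h1
    have : ((0, 1) : BiPoly) * T0 + (1, 0) * T1 = 1 := by simp [T0, T1]
    simpa [h0, h1] using congrArg φ this
  refine ⟨fun j => const (p j), Sum.elim (fun _ => 0) fun _ => 1,
    Sum.elim (fun _ => l) fun i j => const (n i j), ?_, ?_, ?_, ?_, ?_, ?_, ?_, ?_, ?_, ?_, ?_⟩
  · intro j; exact hasDeg_const _
  · rintro (i | i)
    · exact hasDeg_zero _
    · exact hasDeg_one
  · rintro (i | i) j
    · simp only [Sum.elim_inl]
      fin_cases j <;> simp only [Fin.zero_eta, Fin.mk_one, Fin.reduceFinMk, l0, l1, l2]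
      · exact ((hasDeg_T0.const_mul _).add (hasDeg_T1.const_mul _)).neg
      · exact hasDeg_T0.const_mul _
      · exact hasDeg_T1.const_mul _
    · exact hasDeg_const _
  · rintro (i | i)
    · simp only [Sum.elim_inl]; ring
    · simp only [Sum.elim_inr, n0, map_sub, map_mul]; ring
  · rintro (i | i)
    · simp only [Sum.elim_inl]; ring
    · simp only [Sum.elim_inr, n1, map_sub, map_mul]; ring
  · rintro (i | i)
    · simp only [Sum.elim_inl]; ring
    · simp only [Sum.elim_inr, n2, map_sub, map_mul]; ring
  · rintro (i | i)
    · simp only [Sum.elim_inl, l0, l1, l2]; ring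
    · simp only [Sum.elim_inr, n0, n1, n2, map_sub, map_mul]; ring
  · rintro (i | i)
    · simp only [Sum.elim_inl, l0, l1, l2]; ring
    · simp only [Sum.elim_inr, n0, n1, n2, map_sub, map_mul]; ring
  · intro K _ φ h
    exact (cp K φ h).elim
  · rintro (i | i) K _ φ h0 h1 h2
    · simp only [Sum.elim_inl, l1, l2, map_mul, mul_eq_zero, cp, false_or] at h1 h2
      exact hT K φ h1 h2
    · refine cq i K φ ?_
      simp only [Sum.elim_inr, n2] at h2
      rw [← neg_eq_zero, ← map_neg, ← map_neg, ← h2]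
      congr 2; ring
  · intro R _ _ _ φ ψ _ h
    have h12 := (par_iff.1 (h (.inl ()))).2.2
    simp only [Sum.elim_inl, l1, l2, map_mul, algHom_const] at h12
    have u : IsUnit (algebraMap ℂ R (p 0)) := hp.isUnit.map _
    apply (u.mul u).mul_left_cancel
    linear_combination h12

/-! ### Classes represented for a dense set of configurations of points -/

open BiPoly

/-- The function `F` is polynomial along all affine lines. -/
def PolyOnLines {V : Type*} [AddCommGroup V] [Module ℂ V] (F : V → ℂ) : Prop :=
  ∀ P Q, ∃ p : Polynomial ℂ, ∀ t : ℂ, F (P + t • Q) = p.eval t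

namespace PolyOnLines

variable {V : Type*} [AddCommGroup V] [Module ℂ V] {F G : V → ℂ}

theorem add (hF : PolyOnLines F) (hG : PolyOnLines G) : PolyOnLines fun P => F P + G P := by
  intro P Q
  obtain ⟨p, hp⟩ := hF P Q
  obtain ⟨q, hq⟩ := hG P Q
  exact ⟨p + q, by simp [hp, hq]⟩

theorem sub (hF : PolyOnLines F) (hG : PolyOnLines G) : PolyOnLines fun P => F P - G P := by
  intro P Q
  obtain ⟨p, hp⟩ := hF P Q
  obtain ⟨q, hq⟩ := hG P Q
  exact ⟨p - q, by simp [hp, hq]⟩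

theorem neg (hF : PolyOnLines F) : PolyOnLines fun P => -F P := by
  intro P Q
  obtain ⟨p, hp⟩ := hF P Q
  exact ⟨-p, by simp [hp]⟩

theorem mul (hF : PolyOnLines F) (hG : PolyOnLines G) : PolyOnLines fun P => F P * G P := by
  intro P Q
  obtain ⟨p, hp⟩ := hF P Q
  obtain ⟨q, hq⟩ := hG P Q
  exact ⟨p * q, by simp [hp, hq]⟩

theorem coord {ι : Type*} (i : ι) (j : Fin 3) :
    PolyOnLines fun P : ι → Fin 3 → ℂ => P i j := by
  intro P Q
  exact ⟨Polynomial.C (P i j) + Polynomial.X * Polynomial.C (Q i j), fun t => by simp; exact mul_comm _ _⟩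

/-- On the line through `P` and `R` the function is a nonzero polynomial with finitely many zeros,
so `P` is a limit of points where it does not vanish. -/
theorem dense_ne_zero [TopologicalSpace V] [ContinuousAdd V] [ContinuousSMul ℂ V]
    (hF : PolyOnLines F) {R : V} (hR : F R ≠ 0) : Dense {P | F P ≠ 0} := by
  intro P
  obtain ⟨p, hp⟩ := hF P (R - P)
  have hp0 : p ≠ 0 := by
    rintro rfl
    have := hp 1
    simp [hR] at this
  have hd : Dense {t : ℂ | p.eval t ≠ 0} := by
    have : {t : ℂ | p.eval t ≠ 0} = (↑p.roots.toFinset : Set ℂ)ᶜ := by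
      ext t; simp [hp0]
    rw [this]
    exact (Finset.finite_toSet _).countable.dense_compl ℂ
  have hc : Continuous fun t : ℂ => P + t • (R - P) := by fun_prop
  have := map_mem_closure hc (hd 0) (t := {P | F P ≠ 0}) fun t ht => by
    simpa [hp] using ht
  simpa using this

end PolyOnLines

theorem dense_forall_of_isOpen {X α : Type*} [TopologicalSpace X] [BaireSpace X] [Finite α]
    {s : α → Set X} (ho : ∀ a, IsOpen (s a)) (hd : ∀ a, Dense (s a)) : Dense {x | ∀ a, x ∈ s a} := by
  have := dense_iInter_of_isOpen ho hd
  rwa [show ⋂ a, s a = {x | ∀ a, x ∈ s a} by ext; simp] at this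

theorem isOpen_forall_of_isOpen {X α : Type*} [TopologicalSpace X] [Finite α]
    {s : α → Set X} (ho : ∀ a, IsOpen (s a)) : IsOpen {x | ∀ a, x ∈ s a} := by
  have := isOpen_iInter_of_finite ho
  rwa [show ⋂ a, s a = {x | ∀ a, x ∈ s a} by ext; simp] at this

/-- Configurations of points that are pairwise distinct and away from the line at infinity. -/
def distinctPoints (ι : Type) : Set (ι → Fin 3 → ℂ) :=
  {P | ∀ i j, i ≠ j → P i 0 * P j 1 - P i 1 * P j 0 ≠ 0} ∩ {P | ∀ i, P i 0 ≠ 0}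

theorem isOpen_dense_distinctPoints (ι : Type) [Finite ι] :
    IsOpen (distinctPoints ι) ∧ Dense (distinctPoints ι) := by
  classical
  have o1 : ∀ q : {q : ι × ι // q.1 ≠ q.2},
      IsOpen {P : ι → Fin 3 → ℂ | P q.1.1 0 * P q.1.2 1 - P q.1.1 1 * P q.1.2 0 ≠ 0} := by
    intro q
    exact isOpen_ne_fun (by fun_prop) (by fun_prop)
  have d1 : ∀ q : {q : ι × ι // q.1 ≠ q.2},
      Dense {P : ι → Fin 3 → ℂ | P q.1.1 0 * P q.1.2 1 - P q.1.1 1 * P q.1.2 0 ≠ 0} := by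
    rintro ⟨⟨i, j⟩, hij⟩
    refine PolyOnLines.dense_ne_zero
      (((PolyOnLines.coord i 0).mul (.coord j 1)).sub ((PolyOnLines.coord i 1).mul (.coord j 0)))
      (R := fun k => if k = i then ![1, 0, 0] else ![0, 1, 0]) ?_
    simp [Ne.symm hij]
  have o2 : ∀ i : ι, IsOpen {P : ι → Fin 3 → ℂ | P i 0 ≠ 0} := fun i =>
    isOpen_ne_fun (by fun_prop) (by fun_prop)
  have d2 : ∀ i : ι, Dense {P : ι → Fin 3 → ℂ | P i 0 ≠ 0} := fun i =>
    (PolyOnLines.coord i 0).dense_ne_zero (R := fun _ => ![1, 0, 0]) (by simp)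
  have e1 : {P : ι → Fin 3 → ℂ | ∀ i j, i ≠ j → P i 0 * P j 1 - P i 1 * P j 0 ≠ 0} =
      {P | ∀ q : {q : ι × ι // q.1 ≠ q.2},
        P ∈ {P | P q.1.1 0 * P q.1.2 1 - P q.1.1 1 * P q.1.2 0 ≠ 0}} := by
    ext P; simp
  rw [distinctPoints, e1]
  have O1 := isOpen_forall_of_isOpen o1
  have O2 := isOpen_forall_of_isOpen o2
  exact ⟨O1.inter O2, (dense_forall_of_isOpen o1 d1).inter_of_isOpen_left
    (dense_forall_of_isOpen o2 d2) O1⟩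

/-! ### The Cremona transformation on configurations of points -/

section Cremona

open Matrix

variable {κ : Type}

/-- The matrix of the first three points. -/
def frame (P : Fin 3 ⊕ κ → Fin 3 → ℂ) : Matrix (Fin 3) (Fin 3) ℂ := of fun a j => P (.inl j) a

/-- The inverse of the matrix of the first three points. -/
noncomputable def frameInv (P : Fin 3 ⊕ κ → Fin 3 → ℂ) : Matrix (Fin 3) (Fin 3) ℂ :=
  (frame P).det⁻¹ • (frame P).adjugate

/-- The first three points are not collinear and the other ones are not on the lines through two
of them. -/
def cremonaDomain (κ : Type) : Set (Fin 3 ⊕ κ → Fin 3 → ℂ) :=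
  {P | (frame P).det ≠ 0} ∩ {P | ∀ q : κ × Fin 3, ((frame P).adjugate *ᵥ P (.inr q.1)) q.2 ≠ 0}

/-- The quadratic Cremona transformation based at the first three points. -/
noncomputable def cremonaMap (P : Fin 3 ⊕ κ → Fin 3 → ℂ) : Fin 3 ⊕ κ → Fin 3 → ℂ :=
  Sum.elim (fun j => P (.inl j)) fun i => frame P *ᵥ (frameInv P *ᵥ P (.inr i))⁻¹

theorem continuous_frame : Continuous (frame (κ := κ)) :=
  continuous_matrix fun i j => by unfold frame; simp only [of_apply]; fun_prop

theorem isOpen_dense_cremonaDomain (κ : Type) [Finite κ] :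
    IsOpen (cremonaDomain κ) ∧ Dense (cremonaDomain κ) := by
  have o1 : IsOpen {P : Fin 3 ⊕ κ → Fin 3 → ℂ | (frame P).det ≠ 0} :=
    isOpen_ne_fun continuous_frame.matrix_det continuous_const
  have d1 : Dense {P : Fin 3 ⊕ κ → Fin 3 → ℂ | (frame P).det ≠ 0} := by
    -- At the coordinate points the frame is the identity matrix.
    refine PolyOnLines.dense_ne_zero (R := Sum.elim coordPt fun _ => 0) ?_ ?_
    · simp only [det_fin_three, frame, of_apply]
      repeat' first | exact .coord _ _ | apply PolyOnLines.add | apply PolyOnLines.sub | apply PolyOnLines.mul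
    · simp [det_fin_three, frame, coordPt]
  have o2 : ∀ q : κ × Fin 3, IsOpen {P : Fin 3 ⊕ κ → Fin 3 → ℂ |
      ((frame P).adjugate *ᵥ P (.inr q.1)) q.2 ≠ 0} := by
    intro q
    refine isOpen_ne_fun ?_ continuous_const
    exact (continuous_apply q.2).comp
      (continuous_frame.matrix_adjugate.matrix_mulVec (continuous_apply (Sum.inr q.1)))
  have d2 : ∀ q : κ × Fin 3, Dense {P : Fin 3 ⊕ κ → Fin 3 → ℂ |
      ((frame P).adjugate *ᵥ P (.inr q.1)) q.2 ≠ 0} := by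
    rintro ⟨i, j⟩
    refine PolyOnLines.dense_ne_zero (R := Sum.elim coordPt fun _ => coordPt j) ?_ ?_
    · simp only [adjugate_fin_three, frame, of_apply, mulVec, dotProduct, Fin.sum_univ_three]
      fin_cases j <;> simp <;>
      repeat' first | exact .coord _ _ | apply PolyOnLines.add | apply PolyOnLines.sub | apply PolyOnLines.mul | apply PolyOnLines.neg
    · simp only [adjugate_fin_three, frame, of_apply, mulVec, dotProduct, Fin.sum_univ_three]
      fin_cases j <;> simp [coordPt]
  have O2 := isOpen_forall_of_isOpen o2
  exact ⟨o1.inter O2, d1.inter_of_isOpen_left (dense_forall_of_isOpen o2 d2) o1⟩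

theorem frameInv_mul_frame {P : Fin 3 ⊕ κ → Fin 3 → ℂ} (hP : P ∈ cremonaDomain κ) :
    frameInv P * frame P = 1 := by
  rw [frameInv, smul_mul, adjugate_mul, smul_smul, inv_mul_cancel₀ hP.1, one_smul]

theorem frame_mul_frameInv {P : Fin 3 ⊕ κ → Fin 3 → ℂ} (hP : P ∈ cremonaDomain κ) :
    frame P * frameInv P = 1 := mul_eq_one_comm.1 (frameInv_mul_frame hP)

theorem frameInv_mulVec_ne {P : Fin 3 ⊕ κ → Fin 3 → ℂ} (hP : P ∈ cremonaDomain κ) (i : κ)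
    (j : Fin 3) : (frameInv P *ᵥ P (.inr i)) j ≠ 0 := by
  rw [frameInv, smul_mulVec]
  exact mul_ne_zero (inv_ne_zero hP.1) (hP.2 (i, j))

theorem frame_cremonaMap (P : Fin 3 ⊕ κ → Fin 3 → ℂ) : frame (cremonaMap P) = frame P := rfl

theorem frameInv_mulVec_cremonaMap {P : Fin 3 ⊕ κ → Fin 3 → ℂ} (hP : P ∈ cremonaDomain κ)
    (i : κ) : frameInv P *ᵥ cremonaMap P (.inr i) = (frameInv P *ᵥ P (.inr i))⁻¹ := by
  rw [cremonaMap, Sum.elim_inr, mulVec_mulVec, frameInv_mul_frame hP, one_mulVec]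

theorem cremonaMap_mem {P : Fin 3 ⊕ κ → Fin 3 → ℂ} (hP : P ∈ cremonaDomain κ) :
    cremonaMap P ∈ cremonaDomain κ := by
  refine ⟨hP.1, fun q hq => ?_⟩
  have h := congrFun (frameInv_mulVec_cremonaMap hP q.1) q.2
  rw [frameInv, smul_mulVec, Pi.smul_apply, ← frame_cremonaMap, hq, smul_zero] at h
  exact inv_ne_zero (frameInv_mulVec_ne hP q.1 q.2) h.symm

/-- The frame is unchanged, and in its coordinates the map is coordinatewise inversion. -/
theorem cremonaMap_cremonaMap {P : Fin 3 ⊕ κ → Fin 3 → ℂ} (hP : P ∈ cremonaDomain κ) :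
    cremonaMap (cremonaMap P) = P := by
  funext i
  rcases i with i | i
  · rfl
  · change frame P *ᵥ (frameInv P *ᵥ cremonaMap P (.inr i))⁻¹ = _
    rw [frameInv_mulVec_cremonaMap hP, inv_inv, mulVec_mulVec, frame_mul_frameInv hP, one_mulVec]

theorem continuousAt_cremonaMap {P : Fin 3 ⊕ κ → Fin 3 → ℂ} (hP : P ∈ cremonaDomain κ) :
    ContinuousAt cremonaMap P := by
  have hinv : ContinuousAt (frameInv (κ := κ)) P :=
    (continuous_frame.matrix_det.continuousAt.inv₀ hP.1).smul
      continuous_frame.matrix_adjugate.continuousAt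
  refine continuousAt_pi.2 fun i => ?_
  rcases i with i | i
  · exact (continuous_apply (Sum.inl i)).continuousAt
  · have hm : Continuous fun q : Matrix (Fin 3) (Fin 3) ℂ × (Fin 3 → ℂ) => q.1 *ᵥ q.2 :=
      continuous_fst.matrix_mulVec continuous_snd
    have h1 : ContinuousAt (fun P => frameInv P *ᵥ P (.inr i)) P :=
      ContinuousAt.comp (f := fun P => (frameInv P, P (.inr i))) hm.continuousAt
        (hinv.prodMk (continuous_apply (Sum.inr i)).continuousAt)
    have h2 : ContinuousAt (fun P => (frameInv P *ᵥ P (.inr i))⁻¹) P :=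
      continuousAt_pi.2 fun j => ((continuousAt_pi.1 h1) j).inv₀ (frameInv_mulVec_ne hP i j)
    exact ContinuousAt.comp (f := fun P => (frame P, (frameInv P *ᵥ P (.inr i))⁻¹))
      hm.continuousAt (continuous_frame.continuousAt.prodMk h2)

theorem frame_mulVec_coordPt (P : Fin 3 ⊕ κ → Fin 3 → ℂ) (j : Fin 3) :
    frame P *ᵥ coordPt j = P (.inl j) := by
  funext a
  fin_cases j <;> simp [frame, coordPt, mulVec, dotProduct, Fin.sum_univ_three]

/-- Conjugation by the frame reduces to base points at the coordinate points. -/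
theorem HasCurve.cremonaMap {P : Fin 3 ⊕ κ → Fin 3 → ℂ} (hP : P ∈ cremonaDomain κ)
    {d a0 a1 a2 : ℤ} {b : κ → ℤ} (h : HasCurve P d (Sum.elim ![a0, a1, a2] b)) :
    HasCurve (cremonaMap P) (2 * d - a0 - a1 - a2)
      (Sum.elim ![d - a1 - a2, d - a0 - a2, d - a0 - a1] b) := by
  have h1 := h.mulVec (frameInv P) (frame P) (frame_mul_frameInv hP)
  have e1 : (fun i => frameInv P *ᵥ P i) = Sum.elim coordPt fun i => frameInv P *ᵥ P (.inr i) := by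
    funext i
    rcases i with i | i
    · rw [← frame_mulVec_coordPt P, mulVec_mulVec, frameInv_mul_frame hP, one_mulVec]; rfl
    · rfl
  rw [e1] at h1
  have h2 := (h1.cremona_coordPt (frameInv_mulVec_ne hP)).mulVec (frame P) (frameInv P)
    (frameInv_mul_frame hP)
  convert h2 using 1
  funext i
  rcases i with i | i
  · exact (frame_mulVec_coordPt P i).symm
  · rfl

/-- To find a good configuration near `P`, choose one near the image of `P` and map it back: the
transformation is an involution and continuous on its open domain. -/
theorem dense_hasCurve_cremona [Finite κ] {d a0 a1 a2 : ℤ} {b : κ → ℤ}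
    (h : Dense {P : Fin 3 ⊕ κ → Fin 3 → ℂ | HasCurve P d (Sum.elim ![a0, a1, a2] b)}) :
    Dense {P : Fin 3 ⊕ κ → Fin 3 → ℂ | HasCurve P (2 * d - a0 - a1 - a2)
      (Sum.elim ![d - a1 - a2, d - a0 - a2, d - a0 - a1] b)} := by
  obtain ⟨hUo, hUd⟩ := isOpen_dense_cremonaDomain κ
  refine dense_iff_inter_open.2 fun O hO hne => ?_
  obtain ⟨P, hPO, hPU⟩ := hUd.inter_open_nonempty O hO hne
  have hPU' := cremonaMap_mem hPU
  have hc := continuousAt_cremonaMap hPU'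
  have hn : cremonaMap ⁻¹' O ∩ cremonaDomain κ ∈ nhds (cremonaMap P) := by
    refine Filter.inter_mem (hc ?_) (hUo.mem_nhds hPU')
    rw [cremonaMap_cremonaMap hPU]
    exact hO.mem_nhds hPO
  obtain ⟨Q, ⟨hQO, hQU⟩, hQ⟩ := mem_closure_iff_nhds.1 (h (cremonaMap P)) _ hn
  exact ⟨_, hQO, hQ.cremonaMap hQU⟩

end Cremona

/-- The class of degree `d` with multiplicities the elements of `S` is represented by an embedded
rational curve, for a dense set of configurations of points. -/
def IsRealizable (d : ℤ) (S : Multiset ℤ) : Prop :=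
  ∃ (ι : Type) (_ : Fintype ι) (c : ι → ℤ), Finset.univ.val.map c = S ∧
    Dense {P : ι → Fin 3 → ℂ | HasCurve P d c}

theorem exists_equiv_of_map_univ_eq {ι κ α : Type} [Fintype ι] [Fintype κ] {f : ι → α} {g : κ → α}
    (h : Finset.univ.val.map f = Finset.univ.val.map g) : ∃ σ : κ ≃ ι, f ∘ σ = g := by
  classical
  have hc : ∀ a, Fintype.card {x // g x = a} = Fintype.card {x // f x = a} := by
    intro a
    have := congrArg (Multiset.count a) h
    rw [Multiset.count_map, Multiset.count_map] at this
    rw [Fintype.card_subtype, Fintype.card_subtype]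
    simp only [Finset.card_def, Finset.filter_val, eq_comm (b := a)]
    exact this.symm
  refine ⟨Equiv.ofFiberEquiv fun a => Fintype.equivOfCardEq (hc a), ?_⟩
  funext x
  exact Equiv.ofFiberEquiv_map _ x

theorem map_univ_sumElim {ι κ α : Type} [Fintype ι] [Fintype κ] (f : ι → α) (g : κ → α) :
    (Finset.univ : Finset (ι ⊕ κ)).val.map (Sum.elim f g) =
      Finset.univ.val.map f + Finset.univ.val.map g := by
  rw [← Finset.univ_disjSum_univ]
  change Multiset.map _ (Multiset.map _ _ + Multiset.map _ _) = _
  rw [Multiset.map_add, Multiset.map_map, Multiset.map_map, Sum.elim_comp_inl, Sum.elim_comp_inr]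

theorem dense_hasCurve_reindex {ι κ : Type} {d : ℤ} {c : ι → ℤ} (σ : κ ≃ ι)
    (h : Dense {P : ι → Fin 3 → ℂ | HasCurve P d c}) :
    Dense {P : κ → Fin 3 → ℂ | HasCurve P d (c ∘ σ)} := by
  have hs : Function.Surjective fun P : ι → Fin 3 → ℂ => P ∘ σ := fun P =>
    ⟨P ∘ σ.symm, by funext i; simp⟩
  refine (hs.denseRange.dense_image (by fun_prop) h).mono ?_
  rintro _ ⟨P, hP, rfl⟩
  exact HasCurve.reindex σ hP

namespace IsRealizable

variable {d : ℤ} {S : Multiset ℤ}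

/-- Labellings with the same multiset of multiplicities differ by a bijection, so any three entries
may serve as base points of a Cremona move. -/
theorem dense (h : IsRealizable d S) {κ : Type} [Fintype κ] {c : κ → ℤ}
    (hc : Finset.univ.val.map c = S) : Dense {P : κ → Fin 3 → ℂ | HasCurve P d c} := by
  obtain ⟨ι, _, c', hc', hd⟩ := h
  obtain ⟨σ, rfl⟩ := exists_equiv_of_map_univ_eq (hc'.trans hc.symm)
  exact dense_hasCurve_reindex σ hd

theorem cremona {a0 a1 a2 : ℤ} (h : IsRealizable d ({a0, a1, a2} + S)) :
    IsRealizable (2 * d - a0 - a1 - a2) ({d - a1 - a2, d - a0 - a2, d - a0 - a1} + S) := by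
  have key : ∀ u v w : ℤ, Finset.univ.val.map
      (Sum.elim ![u, v, w] fun i : Fin S.toList.length => S.toList.get i) = {u, v, w} + S := by
    intro u v w
    rw [map_univ_sumElim, Fin.univ_val_map, Fin.univ_val_map, List.ofFn_get, Multiset.coe_toList]
    rfl
  exact ⟨_, inferInstance, _, key _ _ _, dense_hasCurve_cremona (h.dense (key _ _ _))⟩

theorem exceptionalDivisor (n : ℕ) : IsRealizable 0 ({-1} + n • {0}) := by
  refine ⟨Unit ⊕ Fin n, inferInstance, Sum.elim (fun _ => -1) fun _ => 0, ?_, ?_⟩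
  · rw [map_univ_sumElim]
    simp [Multiset.nsmul_singleton]
  · refine (isOpen_dense_distinctPoints _).2.mono fun P hP => ?_
    have := HasCurve.exceptionalDivisor (p := P (.inl ())) (Q := fun i => P (.inr i))
      (hP.2 _) fun i => sub_ne_zero.1 (hP.1 (.inl ()) (.inr i) (by simp))
    have e : P = Sum.elim (fun _ => P (.inl ())) fun i => P (.inr i) := by
      funext i; rcases i with i | i <;> rfl
    rw [Set.mem_ofPred_eq, e]
    exact this

end IsRealizable

/-! ### From rational curves to symplectic spheres -/

open BiPoly

/-- Three sections without common zeros as a smooth sphere in the plane. -/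
noncomputable def sphereOfSections (d : ℤ) (x : Fin 3 → BiPoly) (hx : ∀ j, HasDeg d (x j))
    (h0 : ∀ (K : Type) [Field K] (φ : BiPoly →+* K),
      φ (x 0) = 0 → φ (x 1) = 0 → φ (x 2) = 0 → False) : SmoothSphere where
  u z j := (x j).1.eval z
  v w j := (x j).2.eval w
  smooth_u := contDiff_pi.2 fun j => (show ContDiff ℂ _ fun z => (x j).1.eval z from by
    simpa using (x j).1.contDiff_aeval (𝕜 := ℂ) (R := ℂ) ∞).restrict_scalars ℝ
  smooth_v := contDiff_pi.2 fun j => (show ContDiff ℂ _ fun z => (x j).2.eval z from by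
    simpa using (x j).2.contDiff_aeval (𝕜 := ℂ) (R := ℂ) ∞).restrict_scalars ℝ
  u_ne_zero z h := h0 ℂ ((Polynomial.evalRingHom z).comp (RingHom.fst _ _))
    (congrFun h 0) (congrFun h 1) (congrFun h 2)
  v_ne_zero w h := h0 ℂ ((Polynomial.evalRingHom w).comp (RingHom.snd _ _))
    (congrFun h 0) (congrFun h 1) (congrFun h 2)
  deg := d
  glue z hz := by
    funext j
    simp [hx j z hz]

/-- Evaluation at a point of the sphere. -/
noncomputable def evalAt (s : OnePoint ℂ) : BiPoly →ₐ[ℂ] ℂ :=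
  s.elim ((Polynomial.aeval 0).comp (AlgHom.snd ℂ _ _))
    fun z => (Polynomial.aeval z).comp (AlgHom.fst ℂ _ _)

theorem eq_of_evalAt {s t : OnePoint ℂ}
    (h : evalAt s T0 * evalAt t T1 = evalAt s T1 * evalAt t T0) : s = t := by
  induction s using OnePoint.rec <;> induction t using OnePoint.rec <;>
    simp_all [evalAt, T0, T1]

theorem sphereOfSections_toMap {d : ℤ} {x : Fin 3 → BiPoly} (hx h0) (s : OnePoint ℂ) :
    ∃ h, (sphereOfSections d x hx h0).toMap s =
      Projectivization.mk ℂ (fun j => evalAt s (x j)) h := by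
  have h : (fun j => evalAt s (x j)) ≠ 0 := fun h => h0 ℂ (evalAt s).toRingHom
    (congrFun h 0) (congrFun h 1) (congrFun h 2)
  refine ⟨h, ?_⟩
  induction s using OnePoint.rec <;> rfl

theorem par_of_mk_eq_mk {a b : Fin 3 → ℂ} {ha : a ≠ 0} {hb : b ≠ 0}
    (h : Projectivization.mk ℂ a ha = Projectivization.mk ℂ b hb) : Par a b := by
  obtain ⟨t, rfl⟩ := (Projectivization.mk_eq_mk_iff' ℂ _ _ ha hb).1 h
  intro i j
  simp only [Pi.smul_apply, smul_eq_mul]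
  ring

/-- The Fubini-Study form on a complex line of tangent vectors. -/
theorem fubiniStudy_smul_I (u a : Fin 3 → ℂ) :
    fubiniStudy u a (Complex.I • a) = (Complex.normSq (a 0 * u 1 - a 1 * u 0) +
      Complex.normSq (a 0 * u 2 - a 2 * u 0) + Complex.normSq (a 1 * u 2 - a 2 * u 1)) /
      (star u ⬝ᵥ u).re ^ 2 := by
  unfold fubiniStudy
  congr 1
  have : (star a ⬝ᵥ (Complex.I • a)) * (star u ⬝ᵥ u) - (star a ⬝ᵥ u) * (star u ⬝ᵥ (Complex.I • a)) =
      Complex.I * ((Complex.normSq (a 0 * u 1 - a 1 * u 0) +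
      Complex.normSq (a 0 * u 2 - a 2 * u 0) + Complex.normSq (a 1 * u 2 - a 2 * u 1) : ℝ) : ℂ) := by
    push_cast
    simp only [Complex.normSq_eq_conj_mul_self, map_sub, map_mul, dotProduct,
      Fin.sum_univ_three, Pi.star_apply, Pi.smul_apply, smul_eq_mul, RCLike.star_def]
    ring
  rw [this, Complex.I_mul_im, Complex.ofReal_re]

/-- The map is holomorphic, so its derivative along `I` is `I` times its derivative along `1`. -/
theorem fsDensity_eval (p : Fin 3 → Polynomial ℂ) (z : ℂ) :
    fsDensity (fun z j => (p j).eval z) z = fubiniStudy (fun j => (p j).eval z)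
      (fun j => (p j).derivative.eval z) (Complex.I • fun j => (p j).derivative.eval z) := by
  have h : HasDerivAt (fun z j => (p j).eval z) (fun j => (p j).derivative.eval z) z :=
    hasDerivAt_pi.2 fun j => (p j).hasDerivAt z
  have h' := (h.hasFDerivAt.restrictScalars ℝ).fderiv
  rw [fsDensity, h']
  simp

theorem fsDensity_eval_nonneg (p : Fin 3 → Polynomial ℂ) (z : ℂ) :
    0 ≤ fsDensity (fun z j => (p j).eval z) z := by
  rw [fsDensity_eval, fubiniStudy_smul_I]
  have := Complex.normSq_nonneg
  exact div_nonneg (add_nonneg (add_nonneg (this _) (this _)) (this _)) (sq_nonneg _)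

/-- The numerator of the density is the sum of the squared norms of the minors of `p'` and `p`. -/
theorem par_of_fsDensity_eval_eq_zero (p : Fin 3 → Polynomial ℂ) (z : ℂ)
    (h0 : (fun j => (p j).eval z) ≠ 0) (h : fsDensity (fun z j => (p j).eval z) z = 0) :
    Par (fun j => (p j).derivative.eval z) fun j => (p j).eval z := by
  rw [fsDensity_eval, fubiniStudy_smul_I, div_eq_zero_iff] at h
  rcases h with h | h
  · have n := Complex.normSq_nonneg
    have n1 := n ((p 0).derivative.eval z * (p 1).eval z - (p 1).derivative.eval z * (p 0).eval z)
    have n2 := n ((p 0).derivative.eval z * (p 2).eval z - (p 2).derivative.eval z * (p 0).eval z)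
    have n3 := n ((p 1).derivative.eval z * (p 2).eval z - (p 2).derivative.eval z * (p 1).eval z)
    exact par_iff.2 ⟨sub_eq_zero.1 (Complex.normSq_eq_zero.1 (by linarith)),
      sub_eq_zero.1 (Complex.normSq_eq_zero.1 (by linarith)),
      sub_eq_zero.1 (Complex.normSq_eq_zero.1 (by linarith))⟩
  · exfalso
    apply h0
    rw [sq_eq_zero_iff] at h
    have e : (star (fun j => (p j).eval z) ⬝ᵥ fun j => (p j).eval z).re =
        Complex.normSq ((p 0).eval z) + Complex.normSq ((p 1).eval z) +
          Complex.normSq ((p 2).eval z) := by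
      simp [dotProduct, Fin.sum_univ_three, Complex.normSq_apply]
    rw [e] at h
    have n := Complex.normSq_nonneg
    have n1 := n ((p 0).eval z)
    have n2 := n ((p 1).eval z)
    have n3 := n ((p 2).eval z)
    funext j
    have e0 := Complex.normSq_eq_zero.1 (show Complex.normSq ((p 0).eval z) = 0 by linarith)
    have e1 := Complex.normSq_eq_zero.1 (show Complex.normSq ((p 1).eval z) = 0 by linarith)
    have e2 := Complex.normSq_eq_zero.1 (show Complex.normSq ((p 2).eval z) = 0 by linarith)
    fin_cases j
    exacts [e0, e1, e2]

-- Since `ε ^ 2 = 0`, one has `p (z + ε) = p z + ε p' z`, so the minors of `p (z + ε)` and `p z` are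
-- `ε` times those of `p' z` and `p z`.
open DualNumber in
theorem par_aeval_eps {p : Fin 3 → Polynomial ℂ} {z : ℂ}
    (h : Par (fun j => (p j).derivative.eval z) fun j => (p j).eval z) :
    Par (fun j => Polynomial.aeval (algebraMap ℂ ℂ[ε] z + ε) (p j))
      fun j => Polynomial.aeval (algebraMap ℂ ℂ[ε] z) (p j) := by
  intro i j
  have e : (ε : ℂ[ε]) ^ 2 = 0 := by rw [sq]; exact DualNumber.eps_mul_eps
  have := congrArg (algebraMap ℂ ℂ[ε]) (h i j)
  simp only [map_mul] at this
  simp only [Polynomial.aeval_add_of_sq_eq_zero _ _ _ e, Polynomial.aeval_algebraMap_apply,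
    Polynomial.coe_aeval_eq_eval]
  linear_combination ε * this

section

variable {ι : Type} {P : ι → Fin 3 → ℂ} {d : ℤ} {c : ι → ℤ}
  {x : Fin 3 → BiPoly} {e : ι → BiPoly} {l : ι → Fin 3 → BiPoly}

open DualNumber in
/-- A curve is a symplectic immersion, in both charts. -/
theorem IsCurve.density_pos [Fintype ι] (H : IsCurve P d c x e l)
    (π : BiPoly →ₐ[ℂ] Polynomial ℂ)
    (hπ : π T0 = Polynomial.X ∧ π T1 = 1 ∨ π T0 = 1 ∧ π T1 = Polynomial.X) (z : ℂ) :
    0 < fsDensity (fun z j => (π (x j)).eval z) z +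
      ∑ i, fsDensity (fun z j => (π (l i j)).eval z) z := by
  have nx := fsDensity_eval_nonneg (fun j => π (x j)) z
  have nl := fun i => fsDensity_eval_nonneg (fun j => π (l i j)) z
  refine lt_of_le_of_ne (add_nonneg nx (Finset.sum_nonneg fun i _ => nl i)) fun h => ?_
  have hsum := Finset.sum_nonneg fun i (_ : i ∈ Finset.univ) => nl i
  have hx0 : fsDensity (fun z j => (π (x j)).eval z) z = 0 := by linarith
  have hl0 : ∑ i, fsDensity (fun z j => (π (l i j)).eval z) z = 0 := by linarith
  rw [Finset.sum_eq_zero_iff_of_nonneg fun i _ => nl i] at hl0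
  let Φ : BiPoly →+* ℂ := (Polynomial.evalRingHom z).comp π.toRingHom
  have px := par_of_fsDensity_eval_eq_zero (fun j => π (x j)) z
    (fun h => H.x_ne ℂ Φ (congrFun h 0) (congrFun h 1) (congrFun h 2)) hx0
  have pl := fun i => par_of_fsDensity_eval_eq_zero (fun j => π (l i j)) z
    (fun h => H.l_ne i ℂ Φ (congrFun h 0) (congrFun h 1) (congrFun h 2))
    (hl0 i (Finset.mem_univ i))
  -- At zero density no component distinguishes `z + ε` from `z`; separation over the dual numbers
  -- then forces `ε = 0`.
  have key := H.sep ℂ[ε] ((Polynomial.aeval (algebraMap ℂ ℂ[ε] z + ε)).comp π)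
    ((Polynomial.aeval (algebraMap ℂ ℂ[ε] z)).comp π) (par_aeval_eps px)
    fun i => par_aeval_eps (pl i)
  have h1 : (1 : ℂ) = 0 := by
    rcases hπ with ⟨h0, h1⟩ | ⟨h0, h1⟩
    · simpa [h0, h1] using congrArg TrivSqZeroExt.snd key
    · simpa [h0, h1] using congrArg TrivSqZeroExt.snd key
  exact one_ne_zero h1

theorem HasCurve.representedBySymplecticSphere {d : ℤ} {c : List ℤ}
    {P : Fin c.length → Fin 3 → ℂ} (hP : P ∈ distinctPoints (Fin c.length))
    (h : HasCurve P d c.get) : RepresentedBySymplecticSphere d c := by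
  obtain ⟨x, e, l, H⟩ := h
  have hP0 : ∀ i, P i ≠ 0 := fun i h => hP.2 i (congrFun h 0)
  refine ⟨fun i => Projectivization.mk ℂ (P i) (hP0 i), ?_,
    sphereOfSections d x H.deg_x H.x_ne,
    fun i => sphereOfSections _ (l i) (H.deg_l i) (H.l_ne i), ?_, ?_, ?_, ?_, rfl, fun _ => rfl⟩
  · intro i j hij
    by_contra hne
    exact hP.1 i j hne (sub_eq_zero.2 (par_of_mk_eq_mk hij 0 1))
  · intro s i
    obtain ⟨_, hx⟩ := sphereOfSections_toMap H.deg_x H.x_ne s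
    obtain ⟨_, hl⟩ := sphereOfSections_toMap (H.deg_l i) (H.l_ne i) s
    dsimp only
    rw [hx, hl, Projectivization.orthogonal_mk, Projectivization.orthogonal_mk]
    have h1 := congrArg (evalAt s) (H.incid_pt i)
    have h2 := congrArg (evalAt s) (H.incid i)
    simp only [map_add, map_mul, algHom_const, Algebra.algebraMap_self, RingHom.id_apply,
      map_zero] at h1 h2
    rw [Matrix.vec3_dotProduct, Matrix.vec3_dotProduct]
    exact ⟨h1, h2⟩
  · intro s t hst
    -- Over `ℂ` separation is injectivity.
    refine eq_of_evalAt (H.sep ℂ (evalAt s) (evalAt t) ?_ fun i => ?_)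
    · obtain ⟨_, h1⟩ := sphereOfSections_toMap H.deg_x H.x_ne s
      obtain ⟨_, h2⟩ := sphereOfSections_toMap H.deg_x H.x_ne t
      exact par_of_mk_eq_mk (h1.symm.trans ((congrArg Prod.fst hst).trans h2))
    · obtain ⟨_, h1⟩ := sphereOfSections_toMap (H.deg_l i) (H.l_ne i) s
      obtain ⟨_, h2⟩ := sphereOfSections_toMap (H.deg_l i) (H.l_ne i) t
      exact par_of_mk_eq_mk (h1.symm.trans ((congrFun (congrArg Prod.snd hst) i).trans h2))
  · exact H.density_pos (AlgHom.fst ℂ _ _) (Or.inl ⟨rfl, rfl⟩)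
  · exact H.density_pos (AlgHom.snd ℂ _ _) (Or.inr ⟨rfl, rfl⟩)

end

theorem IsRealizable.representedBySymplecticSphere {d : ℤ} {c : List ℤ}
    (h : IsRealizable d (c : Multiset ℤ)) : RepresentedBySymplecticSphere d c := by
  have hd := h.dense (κ := Fin c.length) (c := c.get) (by rw [Fin.univ_val_map, List.ofFn_get])
  obtain ⟨ho, hg⟩ := isOpen_dense_distinctPoints (Fin c.length)
  obtain ⟨P, hP, hP'⟩ := (hg.inter_of_isOpen_left hd ho).nonempty
  exact HasCurve.representedBySymplecticSphere hP hP'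

/-! ### Cremona moves on exceptional classes -/

/-- The class of degree `d` with multiplicities `S` satisfies the Diophantine equations, and it is
represented by an embedded rational curve, also when multiplicities zero are added to it. -/
def IsStable (d : ℤ) (S : Multiset ℤ) : Prop :=
  d ^ 2 - (S.map (· ^ 2)).sum = -1 ∧ 3 * d - S.sum = 1 ∧ ∀ k : ℕ, IsRealizable d (S + k • {0})

namespace IsStable

theorem isExceptional {d : ℤ} {c : List ℤ} (h : IsStable d c) : IsExceptional d c := by
  obtain ⟨h1, h2, h3⟩ := h
  refine ⟨⟨by simpa using h1, by simpa using h2⟩, ?_⟩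
  have := h3 0
  rw [zero_smul, add_zero] at this
  exact this.representedBySymplecticSphere

theorem exceptionalDivisor : IsStable 0 {-1} :=
  ⟨by simp, by simp, IsRealizable.exceptionalDivisor⟩

/-- Supplies fresh base points for later Cremona moves. -/
theorem add_zeros {d : ℤ} {S S' : Multiset ℤ} (h : IsStable d S) (j : ℕ) (hS : S' = S + j • {0}) :
    IsStable d S' := by
  subst hS
  refine ⟨?_, ?_, fun k => ?_⟩
  · rw [← h.1]; simp [Multiset.map_nsmul, Multiset.sum_nsmul]
  · rw [← h.2.1]; simp [Multiset.sum_nsmul]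
  · rw [add_assoc, ← add_smul]; exact h.2.2 _

theorem cremona {d a0 a1 a2 d' : ℤ} {S T S' : Multiset ℤ} (h : IsStable d S)
    (hS : S = {a0} + {a1} + {a2} + T) (hd : d' = 2 * d - a0 - a1 - a2)
    (hS' : S' = {d - a1 - a2} + {d - a0 - a2} + {d - a0 - a1} + T) : IsStable d' S' := by
  subst hS hd hS'
  obtain ⟨h1, h2, h3⟩ := h
  simp only [Multiset.map_add, Multiset.map_singleton, Multiset.sum_add,
    Multiset.sum_singleton] at h1 h2
  refine ⟨?_, ?_, fun k => ?_⟩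
  · simp only [Multiset.map_add, Multiset.map_singleton, Multiset.sum_add, Multiset.sum_singleton]
    linear_combination h1
  · simp only [Multiset.sum_add, Multiset.sum_singleton]
    linear_combination h2
  · have e : ∀ u v w : ℤ, {u} + {v} + {w} + T + k • {0} =
        ({u, v, w} : Multiset ℤ) + (T + k • {0}) := by
      intro u v w
      rw [← add_assoc]
      rfl
    rw [e]
    exact IsRealizable.cremona (e a0 a1 a2 ▸ h3 k)

/-- The composition of `j` Cremona transformations with a common base point of multiplicity `m`. -/
theorem flips (j : ℕ) {d m x y d' m' x' y' : ℤ} {S T S' : Multiset ℤ} (h : IsStable d S)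
    (hS : S = {m} + (j • {x} + j • {y}) + T)
    (hx : x' = d - m - x) (hy : y' = d - m - y)
    (hd : d' = d + j * (d - m - x - y)) (hm : m' = m + j * (d - m - x - y))
    (hS' : S' = {m'} + (j • {x'} + j • {y'}) + T) : IsStable d' S' := by
  -- Each transformation adds `d - m - x - y` to both `d` and `m`. So `d - m` is constant and all
  -- `j` increments agree.
  induction j generalizing d m T S S' with
  | zero => simp_all
  | succ j ih =>
    have h1 : IsStable (d + (d - m - x - y))
        ({m + (d - m - x - y)} + (j • {x} + j • {y}) + ({x'} + {y'} + T)) := by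
      refine h.cremona (a0 := m) (a1 := x) (a2 := y) (T := j • {x} + j • {y} + T) ?_ (by ring) ?_
      · rw [hS, succ_nsmul, succ_nsmul]; abel
      · rw [hx, hy, show d - x - y = m + (d - m - x - y) by ring]; abel
    refine ih h1 rfl ?_ ?_ ?_ ?_ ?_
    · rw [hx]; ring
    · rw [hy]; ring
    · rw [hd]; push_cast; ring
    · rw [hm]; push_cast; ring
    · rw [hS', succ_nsmul, succ_nsmul]; abel

/-- A de Jonquières transformation of degree `j + 1` whose `2 * j` simple base points have equal
multiplicity. -/
theorem flips_same (j : ℕ) {d m x d' m' x' : ℤ} {S T S' : Multiset ℤ} (h : IsStable d S)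
    (hS : S = {m} + (2 * j) • {x} + T) (hx : x' = d - m - x)
    (hd : d' = d + j * (d - m - 2 * x)) (hm : m' = m + j * (d - m - 2 * x))
    (hS' : S' = {m'} + (2 * j) • {x'} + T) : IsStable d' S' := by
  rw [two_mul, add_smul] at hS hS'
  exact h.flips j hS hx hx (by rw [hd]; ring) (by rw [hm]; ring) hS'

/-- The involution of degree five with six base points. -/
theorem quintic {d a b d' a' b' : ℤ} {S T S' : Multiset ℤ} (h : IsStable d S)
    (hS : S = 5 • {a} + {b} + T) (hd : d' = 5 * d - 2 * (5 * a + b))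
    (ha : a' = 2 * d - 4 * a - b) (hb : b' = 2 * d - 5 * a) (hS' : S' = 5 • {a'} + {b'} + T) :
    IsStable d' S' := by
  -- Two Cremona moves use up the six points, and the third is based at the images of the first
  -- triple.
  have h1 : IsStable (2 * d - 3 * a) (3 • {d - 2 * a} + 2 • {a} + {b} + T) := by
    refine h.cremona (a0 := a) (a1 := a) (a2 := a) (T := 2 • {a} + {b} + T) ?_ (by ring) ?_
    · rw [hS]; abel
    · rw [show d - 2 * a = d - a - a by ring]; abel
  have h2 : IsStable (4 * d - 8 * a - b) (3 • {d - 2 * a} + 2 • {a'} + {b'} + T) := by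
    refine h1.cremona (a0 := a) (a1 := a) (a2 := b) (T := 3 • {d - 2 * a} + T) ?_ (by ring) ?_
    · abel
    · rw [ha, hb, show 2 * d - 3 * a - a - b = 2 * d - 4 * a - b by ring,
        show 2 * d - 3 * a - a - a = 2 * d - 5 * a by ring]; abel
  refine h2.cremona (a0 := d - 2 * a) (a1 := d - 2 * a) (a2 := d - 2 * a)
    (T := 2 • {a'} + {b'} + T) ?_ (by rw [hd]; ring) ?_
  · abel
  · rw [hS', show 4 * d - 8 * a - b - (d - 2 * a) - (d - 2 * a) = a' by rw [ha]; ring]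
    abel

end IsStable

/-- The class with degree `s + (n + 1) a` and multiplicities `s + n a`, `W`, where
`r = s + (2 n + 3) a`. -/
def TailStable (n : ℕ) (r a : ℤ) (W : Multiset ℤ) : Prop :=
  IsStable (r - (n + 2) * a) ({r - (n + 3) * a} + W)

/-! ### From the tail class to the six staircases -/

namespace TailStable

variable {n : ℕ} {r a : ℤ} {W : Multiset ℤ}

/-- Degree minus first multiplicity is `a`, so base points of multiplicity zero turn into points of
multiplicity `a`. -/
theorem short (h : TailStable n r a W) : IsStable (r + a) ({r} + (2 * n + 6) • {a} + W) := by
  refine (h.add_zeros (2 * (n + 3)) rfl).flips_same (n + 3) (m := r - (n + 3) * a) (x := 0)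
    (x' := a) (m' := r) (T := W) ?_ ?_ ?_ ?_ ?_
  · abel
  · ring
  · push_cast; ring
  · push_cast; ring
  · congr 2

/-- Here `q` is the numerator after prepending the entry `2 n + 1`. A first move creates the block
of weights `r`, a second turns most of the `a` into `r - a`. -/
theorem long (h : TailStable n r a W) {q : ℤ} (hq : q = (2 * n + 2) * r - (2 * n + 3) * a) :
    IsStable (q + r) ({q} + {a} + (2 * n + 4) • {r - a} + (2 * n + 1) • {r} + W) := by
  have h1 : IsStable (r + a + n * r) ({a + n * r} + (2 * n + 1) • {r} + (2 * n + 5) • {a} + W) := by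
    refine (h.short.add_zeros (2 * n) rfl).flips_same n (m := a) (x := 0)
      (x' := r) (m' := a + n * r) (T := {r} + (2 * n + 5) • {a} + W) ?_ (by ring) (by ring)
      (by ring) ?_
    · module
    · module
  refine h1.flips_same (n + 2) (m := a + n * r) (x := a) (x' := r - a) (m' := q)
    (T := (2 * n + 1) • {r} + {a} + W) ?_ ?_ ?_ ?_ ?_
  · module
  · ring
  · rw [hq]; push_cast; ring
  · rw [hq]; push_cast; ring
  · module

/-- The next tail, with two more blocks of weights. -/
theorem next (h : TailStable n r a W) {q p : ℤ} (hq : q = (2 * n + 2) * r - (2 * n + 3) * a)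
    (hp : p = (2 * n + 5) * q + r) :
    TailStable n p (q + r - a) ((2 * n + 5) • {q} + ((2 * n + 1) • {r} + W)) := by
  refine (h.long hq).flips_same (n + 2) (m := a) (x := r - a) (x' := q)
    (m' := p - (n + 3) * (q + r - a))
    (T := {q} + (2 * n + 1) • {r} + W) ?_ ?_ ?_ ?_ ?_
  · module
  · ring
  · rw [hp]; push_cast; ring
  · rw [hp]; push_cast; ring
  · module

/-- With a new base point of multiplicity zero, all the `a` of `short` become `r` and extend the
block of weights `r` to `2 n + 7`. -/
theorem upper_u (h : TailStable n r a W) :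
    IsStable ((n + 4) * r - (n + 2) * a) ({(n + 3) * (r - a)} + ((2 * n + 7) • {r} + W)) := by
  refine (h.short.add_zeros 1 rfl).flips_same (n + 3) (m := 0) (x := a) (x' := r)
    (m' := (n + 3) * (r - a))
    (T := {r} + W) ?_ ?_ ?_ ?_ ?_
  · module
  · ring
  · push_cast; ring
  · push_cast; ring
  · module

/-- All but six of the `a` become `r`; the quintic involution sends those six to the leading block
of weights `q`. -/
theorem lower_l (h : TailStable n r a W) {q : ℤ} (hq : q = (2 * n + 2) * r - (2 * n + 3) * a) :
    IsStable (5 * (n + 1) * r - (5 * n + 7) * a)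
      ({n * (r - a)} + (6 • {q} + ((2 * n + 1) • {r} + W))) := by
  have h1 : IsStable ((n + 1) * r - (n - 1) * a)
      ({n * (r - a)} + (2 * n + 1) • {r} + 6 • {a} + W) := by
    refine (h.short.add_zeros 1 rfl).flips_same n (m := 0) (x := a) (x' := r)
      (m' := n * (r - a))
      (T := {r} + 6 • {a} + W) ?_ ?_ ?_ ?_ ?_
    · module
    · ring
    · ring
    · ring
    · module
  refine h1.quintic (a := a) (b := a) (a' := q) (b' := q)
    (T := {n * (r - a)} + (2 * n + 1) • {r} + W) ?_ ?_ ?_ ?_ ?_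
  · module
  · ring
  · rw [hq]; ring
  · rw [hq]; ring
  · module

/-- The moves prepare five points of multiplicity `r + a` and one of multiplicity `a`; the quintic
sends them to the blocks of the leading entries `5, 1`. -/
theorem exceptional_u (h : TailStable n r a W) {t q : ℤ}
    (ht : t = (2 * n + 7) * r - (2 * n + 3) * a) (hq : q = t + r) :
    IsStable ((5 * n + 20) * r - (5 * n + 7) * a)
      ({(n + 5) * r - n * a} + (5 • {q} + (1 • {t} + ((2 * n + 6) • {r} + W)))) := by
  have h1 : IsStable (r + 2 * a) ({r + a} + (2 * n + 8) • {a} + W) := by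
    refine (h.short.add_zeros 2 rfl).flips_same 1 (m := r) (x := 0) (x' := a)
      (m' := r + a)
      (T := (2 * n + 6) • {a} + W) ?_ ?_ ?_ ?_ ?_
    · module
    · ring
    · push_cast; ring
    · push_cast; ring
    · module
  have h2 : IsStable (r + 2 * a + (n + 3) * (r - a))
      ({a + (n + 3) * (r - a)} + (2 * n + 6) • {r} + {r + a} + {a} + W) := by
    refine h1.flips_same (n + 3) (m := a) (x := a) (x' := r)
      (m' := a + (n + 3) * (r - a))
      (T := {r + a} + {a} + W) ?_ ?_ ?_ ?_ ?_
    · module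
    · ring
    · push_cast; ring
    · push_cast; ring
    · module
  have h3 : IsStable ((n + 6) * r - (n - 1) * a)
      ({(n + 5) * r - n * a} + (2 * n + 6) • {r} + 5 • {r + a} + {a} + W) := by
    refine (h2.add_zeros 4 rfl).flips_same 2 (m := a + (n + 3) * (r - a)) (x := 0) (x' := r + a)
      (m' := (n + 5) * r - n * a)
      (T := (2 * n + 6) • {r} + {r + a} + {a} + W) ?_ ?_ ?_ ?_ ?_
    · module
    · ring
    · push_cast; ring
    · push_cast; ring
    · module
  refine h3.quintic (a := r + a) (b := a) (a' := q) (b' := t)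
    (T := {(n + 5) * r - n * a} + (2 * n + 6) • {r} + W) ?_ ?_ ?_ ?_ ?_
  · module
  · ring
  · rw [hq, ht]; ring
  · rw [ht]; ring
  · module

/-- The pattern of `lower_l`, starting from `long`: `r - a` plays the role of `a`, and `t` that of
`r`. -/
theorem lower_u {n : ℕ} (h : TailStable (n + 1) r a W) {t q : ℤ}
    (ht : t = (2 * n + 4) * r - (2 * n + 5) * a) (hq : q = (2 * n + 1) * t + r) :
    IsStable (5 * (t + r + n * (t - r + a)) - 12 * (r - a))
      ({a + n * (t - r + a)} + (6 • {q} + ((2 * n + 1) • {t} + ((2 * n + 3) • {r} + W)))) := by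
  have h0 := h.long (q := t) (by rw [ht]; push_cast; ring)
  have h1 : IsStable (t + r + n * (t - r + a))
      ({a + n * (t - r + a)} + (2 * n + 1) • {t} + 6 • {r - a} + (2 * n + 3) • {r} + W) := by
    refine h0.flips_same n (m := a) (x := r - a) (x' := t)
      (m' := a + n * (t - r + a))
      (T := {t} + 6 • {r - a} + (2 * n + 3) • {r} + W) ?_ ?_ ?_ ?_ ?_
    · module
    · ring
    · ring
    · ring
    · module
  refine h1.quintic (a := r - a) (b := r - a) (a' := q) (b' := q)
    (T := {a + n * (t - r + a)} + (2 * n + 1) • {t} + (2 * n + 3) • {r} + W) ?_ ?_ ?_ ?_ ?_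
  · module
  · ring
  · rw [hq, ht]; ring
  · rw [hq, ht]; ring
  · module

/-- The pattern of `exceptional_u`, starting from `long`: the quintic acts on five points of
multiplicity `g` and one of multiplicity `r - a`. -/
theorem exceptional_l (h : TailStable n r a W) {t g v q : ℤ}
    (ht : t = (2 * n + 2) * r - (2 * n + 3) * a) (hg : g = t + r - a)
    (hv : v = (2 * n + 4) * t + r) (hq : q = v + t) :
    IsStable (5 * (n + 4) * g - 10 * g - 2 * (r - a))
      ({(n + 3) * g} +
        (5 • {q} + (1 • {v} + ((2 * n + 4) • {t} + ((2 * n + 1) • {r} + W))))) := by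
  have h1 : IsStable (g + r) ({g} + {r} + (2 * n + 5) • {r - a} + (2 * n + 1) • {r} + W) := by
    refine ((h.long ht).add_zeros 1 rfl).flips 1 (m := t) (x := a) (y := 0) (x' := r - a) (y' := r)
      (m' := g) (T := (2 * n + 4) • {r - a} + (2 * n + 1) • {r} + W) ?_ ?_ ?_ ?_ ?_ ?_
    · module
    · ring
    · ring
    · rw [hg]; push_cast; ring
    · rw [hg]; push_cast; ring
    · module
  have h2 : IsStable (3 * g + r) ({r + 2 * g} + 5 • {g} + (2 * n + 5) • {r - a} +
      (2 * n + 1) • {r} + W) := by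
    refine (h1.add_zeros 4 rfl).flips_same 2 (m := r) (x := 0) (x' := g) (m' := r + 2 * g)
      (T := {g} + (2 * n + 5) • {r - a} + (2 * n + 1) • {r} + W) ?_ ?_ ?_ ?_ ?_
    · module
    · ring
    · push_cast; ring
    · push_cast; ring
    · module
  have h3 : IsStable ((n + 4) * g) ({(n + 3) * g} + 5 • {g} + {r - a} + (2 * n + 4) • {t} +
      (2 * n + 1) • {r} + W) := by
    refine h2.flips_same (n + 2) (m := r + 2 * g) (x := r - a) (x' := t) (m' := (n + 3) * g)
      (T := 5 • {g} + {r - a} + (2 * n + 1) • {r} + W) ?_ ?_ ?_ ?_ ?_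
    · module
    · rw [hg]; ring
    · rw [hg, ht]; push_cast; ring
    · rw [hg, ht]; push_cast; ring
    · module
  refine h3.quintic (a := g) (b := r - a) (a' := q) (b' := v)
    (T := {(n + 3) * g} + (2 * n + 4) • {t} + (2 * n + 1) • {r} + W) ?_ ?_ ?_ ?_ ?_
  · module
  · ring
  · rw [hq, hv, hg, ht]; ring
  · rw [hv, hg, ht]; ring
  · module

end TailStable

/-- The first tail, for the end `2 n + 4`. -/
theorem tailStable_one (n : ℕ) :
    TailStable n (2 * n + 4) 1 ((2 * n + 4) • {1}) := by
  refine (IsStable.exceptionalDivisor.add_zeros (2 * (n + 2)) rfl).flips_same (n + 2) (m := -1)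
    (x := 0) (x' := 1) (m' := 2 * n + 4 - (n + 3) * 1) (T := 0) ?_ ?_ ?_ ?_ ?_
  · module
  · ring
  · push_cast; ring
  · push_cast; ring
  · module

/-- The first tail, for the end `2 n + 5, 2 n + 2`. -/
theorem tailStable_two (n : ℕ) :
    TailStable n ((2 * n + 5) * (2 * n + 2) + 1) (2 * n + 3)
      ((2 * n + 5) • {2 * (n : ℤ) + 2} + (2 * n + 2) • {1}) := by
  have h1 : IsStable (2 * n + 3) ({2 * (n : ℤ) + 2} + (4 * n + 6) • {1}) := by
    refine (IsStable.exceptionalDivisor.add_zeros (2 * (2 * n + 3)) rfl).flips_same (2 * n + 3)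
      (m := -1) (x := 0) (x' := 1) (m' := 2 * n + 2) (T := 0) ?_ ?_ ?_ ?_ ?_
    · module
    · ring
    · push_cast; ring
    · push_cast; ring
    · module
  refine (h1.add_zeros 1 rfl).flips_same (n + 2) (m := 0) (x := 1) (x' := 2 * n + 2)
    (m' := (2 * n + 5) * (2 * n + 2) + 1 - (n + 3) * (2 * n + 3))
    (T := {2 * (n : ℤ) + 2} + (2 * n + 2) • {1}) ?_ ?_ ?_ ?_ ?_
  · module
  · ring
  · push_cast; ring
  · push_cast; ring
  · module

/-! ### Weight expansions and continued fractions -/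

theorem contFrac_bounds {l : List ℕ} (hl : ∀ x ∈ l, 1 ≤ x) :
    (contFrac l).2 ≤ (contFrac l).1 ∧ 0 < (contFrac l).1 := by
  induction l with
  | nil => simp [contFrac]
  | cons a l ih =>
    obtain ⟨h1, h2⟩ := ih fun x hx => hl x (List.mem_cons_of_mem _ hx)
    have ha : 1 ≤ a := hl a List.mem_cons_self
    have : 1 * (contFrac l).1 ≤ a * (contFrac l).1 := Nat.mul_le_mul_right _ ha
    simp only [contFrac]
    omega

theorem contFrac_snd_pos {l : List ℕ} (hl : ∀ x ∈ l, 1 ≤ x) (hne : l ≠ []) :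
    0 < (contFrac l).2 := by
  cases l with
  | nil => exact absurd rfl hne
  | cons a l => exact (contFrac_bounds fun x hx => hl x (List.mem_cons_of_mem _ hx)).2

theorem contFrac_coprime (l : List ℕ) : (contFrac l).1.Coprime (contFrac l).2 := by
  induction l with
  | nil => simp [contFrac]
  | cons a l ih =>
    simp only [contFrac]
    rw [Nat.coprime_mul_right_add_left]
    exact ih.symm

theorem intWeights_zero (p : ℕ) : intWeights p 0 = [] := by
  rw [intWeights, if_pos rfl]

theorem intWeights_of_pos (p : ℕ) {q : ℕ} (hq : 0 < q) :
    (intWeights p q : Multiset ℤ) = (p / q) • {(q : ℤ)} + (intWeights q (p % q) : Multiset ℤ) := by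
  rw [intWeights, if_neg hq.ne', ← Multiset.coe_add, Multiset.nsmul_singleton]
  rfl

theorem intWeights_mul_add (a : ℕ) {x y : ℕ} (hx : 0 < x) (hy : y ≤ x) :
    (intWeights (a * x + y) x : Multiset ℤ) = a • {(x : ℤ)} + (intWeights x y : Multiset ℤ) := by
  rw [intWeights_of_pos _ hx, Nat.mul_add_mod_self_right, add_comm (a * x),
    Nat.add_mul_div_right _ _ hx]
  -- Equality occurs for a continued fraction ending in `1`; the floor then takes one more copy of
  -- `x`.
  rcases hy.lt_or_eq with h | rfl
  · rw [Nat.div_eq_of_lt h, Nat.mod_eq_of_lt h, zero_add]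
  · rw [intWeights_of_pos y hx, Nat.mod_self, Nat.div_self hx, intWeights_zero]
    module

theorem intWeights_add_self (x : ℕ) {y : ℕ} (hy : 0 < y) :
    (intWeights (x + y) y : Multiset ℤ) = {(y : ℤ)} + (intWeights x y : Multiset ℤ) := by
  rw [intWeights_of_pos _ hy, intWeights_of_pos x hy, Nat.add_mod_right, Nat.add_div_right _ hy]
  module

/-- The weights of a continued fraction. -/
def weights (l : List ℕ) : Multiset ℤ := (intWeights (contFrac l).1 (contFrac l).2 : Multiset ℤ)

theorem weights_nil : weights [] = 0 := by
  simp [weights, contFrac, intWeights_zero]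

theorem weights_cons (a : ℕ) {l : List ℕ} (hl : ∀ x ∈ l, 1 ≤ x) :
    weights (a :: l) = a • {((contFrac l).1 : ℤ)} + weights l :=
  intWeights_mul_add a (contFrac_bounds hl).2 (contFrac_bounds hl).1

/-- The periodic part and the end of the continued fractions. -/
def tailList (n : ℕ) (tail : List ℕ) (k : ℕ) : List ℕ :=
  (List.replicate k [2 * n + 5, 2 * n + 1]).flatten ++ tail

theorem tailList_succ (n : ℕ) (tail : List ℕ) (k : ℕ) :
    tailList n tail (k + 1) = (2 * n + 5) :: (2 * n + 1) :: tailList n tail k := by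
  simp [tailList, List.replicate_succ]

theorem tailList_pos (n : ℕ) {tail : List ℕ} (ht : ∀ x ∈ tail, 1 ≤ x) (k : ℕ) :
    ∀ x ∈ tailList n tail k, 1 ≤ x := by
  induction k with
  | zero => simpa [tailList] using ht
  | succ k ih =>
    rw [tailList_succ]
    simpa using ih

/-! ### The staircases -/

/-- The divisibility of `r - s` by `2 n + 3` is carried along with the class; prepending a period
replaces `a` by `q + r - a`. -/
theorem exists_tailStable (n : ℕ) {tail : List ℕ} (ht : tail ∈ [[2 * n + 4], [2 * n + 5, 2 * n + 2]])
    (k : ℕ) : ∃ a : ℤ, ((contFrac (tailList n tail k)).1 : ℤ) =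
      (contFrac (tailList n tail k)).2 + (2 * n + 3) * a ∧
      TailStable n (contFrac (tailList n tail k)).1 a (weights (tailList n tail k)) := by
  have hpos : ∀ x ∈ tail, 1 ≤ x := by
    simp only [List.mem_cons, List.not_mem_nil, or_false] at ht
    rcases ht with rfl | rfl <;> simp
  induction k with
  | zero =>
    simp only [List.mem_cons, List.not_mem_nil, or_false] at ht
    rcases ht with rfl | rfl
    · refine ⟨1, ?_, ?_⟩
      · simp [tailList, contFrac]; ring
      · have h := tailStable_one n
        simp only [tailList, List.replicate_zero, List.flatten_nil, List.nil_append]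
        rw [weights_cons _ (by simp), weights_nil]
        simpa [contFrac] using h
    · refine ⟨2 * n + 3, ?_, ?_⟩
      · simp [tailList, contFrac]; ring
      · have h := tailStable_two n
        simp only [tailList, List.replicate_zero, List.flatten_nil, List.nil_append]
        rw [weights_cons _ (by simp), weights_cons _ (by simp), weights_nil]
        simpa [contFrac] using h
  | succ k ih =>
    obtain ⟨a, ha, h⟩ := ih
    have hp := tailList_pos n hpos k
    rw [tailList_succ, weights_cons _ (by simpa using hp), weights_cons _ hp]
    have hq : (((2 * n + 1) * (contFrac (tailList n tail k)).1 +
        (contFrac (tailList n tail k)).2 : ℕ) : ℤ) =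
        (2 * n + 2) * (contFrac (tailList n tail k)).1 - (2 * n + 3) * a := by
      push_cast; linear_combination -ha
    have hp' : (((2 * n + 5) * ((2 * n + 1) * (contFrac (tailList n tail k)).1 +
        (contFrac (tailList n tail k)).2) + (contFrac (tailList n tail k)).1 : ℕ) : ℤ) =
        (2 * n + 5) * (((2 * n + 1) * (contFrac (tailList n tail k)).1 +
        (contFrac (tailList n tail k)).2 : ℕ) : ℤ) + (contFrac (tailList n tail k)).1 := by
      push_cast; ring
    refine ⟨_, ?_, h.next hq hp'⟩
    simp only [contFrac]
    push_cast
    linear_combination -ha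

/-- A criterion for the centers `[pre, {2n+5, 2n+1}^k, end]`. -/
theorem StaircasePerfect.of_tailStable {n : ℕ} {pre : List ℕ} {R₁ R₂ : ℤ} (α β p₁ p₂ q₁ q₂ : ℤ)
    (hpre : ∀ x ∈ pre, 1 ≤ x)
    (H : ∀ (l : List ℕ) (r s a : ℤ), (∀ x ∈ l, 1 ≤ x) → ((contFrac l).1 : ℤ) = r →
      ((contFrac l).2 : ℤ) = s → r = s + (2 * n + 3) * a → TailStable n r a (weights l) →
      ((contFrac (pre ++ l)).1 : ℤ) = p₁ * r + p₂ * a ∧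
      ((contFrac (pre ++ l)).2 : ℤ) = q₁ * r + q₂ * a ∧
      IsStable (α * r + β * a) ({(3 * α - p₁ - q₁) * r + (3 * β - p₂ - q₂) * a} +
        weights (pre ++ l)))
    (h₁ : (2 * n + 3) * α = R₁ * p₁ + R₂ * q₁) (h₂ : (2 * n + 3) * β = R₁ * p₂ + R₂ * q₂) :
    StaircasePerfect n pre R₁ R₂ := by
  intro tail ht
  have hpos : ∀ x ∈ tail, 1 ≤ x := by
    simp only [List.mem_cons, List.not_mem_nil, or_false] at ht
    rcases ht with rfl | rfl <;> simp
  have hne : tail ≠ [] := by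
    simp only [List.mem_cons, List.not_mem_nil, or_false] at ht
    rcases ht with rfl | rfl <;> simp
  choose a ha hs using exists_tailStable n ht
  have hl := tailList_pos n hpos
  set r : ℕ → ℤ := fun k => (contFrac (tailList n tail k)).1 with hr
  set s : ℕ → ℤ := fun k => (contFrac (tailList n tail k)).2 with hs'
  have hcf : ∀ k, stairCF n pre tail k = contFrac (pre ++ tailList n tail k) := by
    intro k
    rw [stairCF, tailList, List.append_assoc]
  have H' := fun k => H (tailList n tail k) (r k) (s k) (a k) (hl k) rfl rfl (ha k) (hs k)
  have ha' : ∀ k, r k = s k + (2 * n + 3) * a k := ha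
  have r1 : ∀ k, r (k + 1) = (2 * n + 5) * ((2 * n + 1) * r k + s k) + r k := by
    intro k; simp only [hr, hs', tailList_succ, contFrac]; push_cast; ring
  have s1 : ∀ k, s (k + 1) = (2 * n + 1) * r k + s k := by
    intro k; simp only [hr, hs', tailList_succ, contFrac]; push_cast; ring
  -- Prepending a period acts on `(r, s)` by a matrix of determinant `1` and trace `σ + 2`.
  have r2 : ∀ k, r (k + 2) = ((2 * n + 1) * (2 * n + 5) + 2) * r (k + 1) - r k := by
    intro k
    rw [r1 (k + 1), s1 k, r1 k]; ring
  have s2 : ∀ k, s (k + 2) = ((2 * n + 1) * (2 * n + 5) + 2) * s (k + 1) - s k := by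
    intro k
    rw [s1 (k + 1), s1 k, r1 k]; ring
  -- As `(2 n + 3) a = r - s`, the recursion for `a` follows on cancelling `2 n + 3`.
  have a2 : ∀ k, a (k + 2) = ((2 * n + 1) * (2 * n + 5) + 2) * a (k + 1) - a k := by
    intro k
    have hn : (2 * n + 3 : ℤ) ≠ 0 := by positivity
    apply mul_left_cancel₀ hn
    linear_combination r2 k - s2 k - ha' (k + 2) +
      ((2 * n + 1) * (2 * n + 5) + 2) * ha' (k + 1) - ha' k
  refine ⟨fun k => α * r k + β * a k,
    fun k => (3 * α - p₁ - q₁) * r k + (3 * β - p₂ - q₂) * a k, ?_⟩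
  simp only [hcf]
  refine ⟨by positivity, ⟨2 * n + 3, by ring⟩, ?_, ?_, ?_, ?_, ?_, ?_⟩
  · intro k
    linear_combination α * r2 k + β * a2 k
  · intro k
    linear_combination (3 * α - p₁ - q₁) * r2 k + (3 * β - p₂ - q₂) * a2 k
  · intro k
    rw [(H' k).1, (H' (k + 1)).1, (H' (k + 2)).1]
    linear_combination p₁ * r2 k + p₂ * a2 k
  · intro k
    rw [(H' k).2.1, (H' (k + 1)).2.1, (H' (k + 2)).2.1]
    linear_combination q₁ * r2 k + q₂ * a2 k
  · intro k
    rw [(H' k).1, (H' k).2.1]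
    linear_combination r k * h₁ + a k * h₂
  · intro k
    refine ⟨contFrac_snd_pos ?_ ?_, contFrac_coprime _, IsStable.isExceptional (H' k).2.2⟩
    · intro x hx
      rcases List.mem_append.1 hx with h | h
      · exact hpre x h
      · exact hl k x h
    · simp [tailList, hne]

/-- Here and below the constants are the coefficients of `d`, `p`, `q` in `r` and `a`: those of `d`
come from the matching `TailStable` lemma, those of `p` and `q` from the continued fraction with `s
= r - (2 n + 3) a` eliminated. -/
theorem staircasePerfect_lower_l (n : ℕ) :
    StaircasePerfect n [6, 2 * n + 1] (n + 1) (-(n - 1)) := by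
  refine .of_tailStable (5 * (n + 1)) (-(5 * n + 7)) (6 * (2 * n + 2) + 1) (-(6 * (2 * n + 3)))
    (2 * n + 2) (-(2 * n + 3)) (by simp) ?_ (by ring) (by ring)
  rintro l r s a hl rfl rfl ha h
  refine ⟨?_, ?_, ?_⟩
  · simp [contFrac]; linear_combination -6 * ha
  · simp [contFrac]; linear_combination -ha
  · have h' := h.lower_l (q := ((contFrac ((2 * n + 1) :: l)).1 : ℤ))
      (by simp [contFrac]; linear_combination -ha)
    rw [List.cons_append, List.cons_append, List.nil_append, weights_cons _ (by simpa using hl),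
      weights_cons _ hl]
    convert h' using 3 <;> ring

theorem staircasePerfect_upper_u (n : ℕ) :
    StaircasePerfect n [2 * n + 7] (n + 2) (-(n + 4)) := by
  refine .of_tailStable (n + 4) (-(n + 2)) (2 * n + 8) (-(2 * n + 3)) 1 0 (by simp) ?_
    (by ring) (by ring)
  rintro l r s a hl rfl rfl ha h
  refine ⟨?_, ?_, ?_⟩
  · simp [contFrac]; linear_combination -ha
  · simp [contFrac]
  · have h' := h.upper_u
    rw [List.cons_append, List.nil_append, weights_cons _ hl]
    convert h' using 3 <;> ring

theorem staircasePerfect_exceptional_u (n : ℕ) :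
    StaircasePerfect n [5, 1, 2 * n + 6] (-(n + 4)) (11 * n + 31) := by
  refine .of_tailStable (5 * n + 20) (-(5 * n + 7)) (12 * n + 47) (-(12 * n + 18))
    (2 * n + 8) (-(2 * n + 3)) (by simp) ?_ (by ring) (by ring)
  rintro l r s a hl rfl rfl ha h
  refine ⟨?_, ?_, ?_⟩
  · simp [contFrac]; linear_combination -6 * ha
  · simp [contFrac]; linear_combination -ha
  · have h' := h.exceptional_u (t := ((contFrac ((2 * n + 6) :: l)).1 : ℤ))
      (q := ((contFrac (1 :: (2 * n + 6) :: l)).1 : ℤ))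
      (by simp [contFrac]; linear_combination -ha) (by simp [contFrac])
    simp only [List.cons_append, List.nil_append]
    rw [weights_cons _ (by simpa using hl), weights_cons _ (by simpa using hl), weights_cons _ hl]
    convert h' using 3 <;> ring

/-- The index is shifted to `n + 1` to avoid the truncated subtraction in the entry `2 n - 1`. -/
theorem staircasePerfect_lower_u (n : ℕ) :
    StaircasePerfect (n + 1) [6, 2 * n + 1, 2 * n + 3] (-n) (11 * n + 13) := by
  refine .of_tailStable (10 * n ^ 2 + 25 * n + 13) (-(10 * n ^ 2 + 30 * n + 13))
    (6 * ((2 * n + 1) * (2 * n + 4) + 1) + (2 * n + 4)) (-(6 * (2 * n + 1) + 1) * (2 * n + 5))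
    ((2 * n + 1) * (2 * n + 4) + 1) (-((2 * n + 1) * (2 * n + 5))) (by simp) ?_
    (by push_cast; ring) (by push_cast; ring)
  rintro l r s a hl rfl rfl ha h
  push_cast at ha
  refine ⟨?_, ?_, ?_⟩
  · simp [contFrac]; linear_combination (-(6 * (2 * n + 1) + 1)) * ha
  · simp [contFrac]; linear_combination (-(2 * n + 1)) * ha
  · have ht : ((contFrac ((2 * n + 3) :: l)).1 : ℤ) =
        (2 * n + 4) * ((contFrac l).1 : ℤ) - (2 * n + 5) * a := by
      simp [contFrac]; linear_combination -ha
    have h' := h.lower_u (t := ((contFrac ((2 * n + 3) :: l)).1 : ℤ))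
      (q := ((contFrac ((2 * n + 1) :: (2 * n + 3) :: l)).1 : ℤ)) ht (by simp [contFrac])
    simp only [List.cons_append, List.nil_append]
    rw [weights_cons _ (by simpa using hl), weights_cons _ (by simpa using hl), weights_cons _ hl]
    convert h' using 3
    · rw [ht]; ring
    · rw [ht]; ring

/-- This staircase consists of the tail classes themselves. -/
theorem staircasePerfect_upper_l (n : ℕ) : StaircasePerfect n [] (n + 1) (n + 2) := by
  refine .of_tailStable 1 (-(n + 2)) 1 0 1 (-(2 * n + 3)) (by simp) ?_ (by ring) (by ring)
  rintro l r s a hl rfl rfl ha h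
  refine ⟨?_, ?_, ?_⟩
  · simp
  · simp; linear_combination -ha
  · rw [List.nil_append]
    unfold TailStable at h
    convert h using 3 <;> ring

theorem staircasePerfect_exceptional_l (n : ℕ) :
    StaircasePerfect n [5, 1, 2 * n + 4, 2 * n + 1] (n + 2) (-(n + 4)) := by
  refine .of_tailStable (2 * ((2 * n + 5) * (2 * n + 2) + 1) + (n + 2) * (2 * n + 3))
    (-(2 * (2 * n + 5) * (2 * n + 3) + (n + 2) * (2 * n + 4)))
    (5 * ((2 * n + 5) * (2 * n + 2) + 1) + (2 * n + 3) ^ 2)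
    (-(5 * (2 * n + 5) * (2 * n + 3) + (2 * n + 4) * (2 * n + 3)))
    ((2 * n + 5) * (2 * n + 2) + 1) (-((2 * n + 5) * (2 * n + 3))) (by simp) ?_ (by ring) (by ring)
  rintro l r s a hl rfl rfl ha h
  refine ⟨?_, ?_, ?_⟩
  · simp [contFrac]; linear_combination (-(5 * (2 * n + 5) + 2 * n + 4)) * ha
  · simp [contFrac]; linear_combination (-(2 * n + 5)) * ha
  · have ht : ((contFrac ((2 * n + 1) :: l)).1 : ℤ) =
        (2 * n + 2) * ((contFrac l).1 : ℤ) - (2 * n + 3) * a := by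
      simp [contFrac]; linear_combination -ha
    have h' := h.exceptional_l (t := ((contFrac ((2 * n + 1) :: l)).1 : ℤ))
      (g := (2 * n + 3) * (contFrac l).1 - (2 * n + 4) * a)
      (v := ((contFrac ((2 * n + 4) :: (2 * n + 1) :: l)).1 : ℤ))
      (q := ((contFrac (1 :: (2 * n + 4) :: (2 * n + 1) :: l)).1 : ℤ)) ht (by rw [ht]; ring)
      (by simp [contFrac]) (by simp [contFrac])
    simp only [List.cons_append, List.nil_append]
    rw [weights_cons _ (by simpa using hl), weights_cons _ (by simpa using hl),
      weights_cons _ (by simpa using hl), weights_cons _ hl]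
    convert h' using 3 <;> ring

/-! ### The Fibonacci staircase -/

theorem fib_odd_add_four (k : ℕ) :
    (Nat.fib (2 * (k + 2) + 1) : ℤ) = 3 * Nat.fib (2 * (k + 1) + 1) - Nat.fib (2 * k + 1) := by
  have h1 : Nat.fib (2 * (k + 2) + 1) = Nat.fib (2 * k + 3) + Nat.fib (2 * k + 4) := Nat.fib_add_two
  have h2 : Nat.fib (2 * k + 4) = Nat.fib (2 * k + 2) + Nat.fib (2 * k + 3) := Nat.fib_add_two
  have h3 : Nat.fib (2 * k + 3) = Nat.fib (2 * k + 1) + Nat.fib (2 * k + 2) := Nat.fib_add_two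
  have h4 : Nat.fib (2 * (k + 1) + 1) = Nat.fib (2 * k + 3) := rfl
  omega

/-- With `s, D, q, p, t` consecutive odd-index Fibonacci numbers and `q = r + s`, one has `t = 6 q +
r`. So the weights of `t / q` are those of `r / s` with `r` and six copies of `q` added, while those
of `q / s` have just `s` added. -/
theorem isStable_fib (k : ℕ) : IsStable (Nat.fib (2 * (k + 1) + 1))
    ({0} + (intWeights (Nat.fib (2 * (k + 2) + 1)) (Nat.fib (2 * k + 1)) : Multiset ℤ)) := by
  induction k using Nat.twoStepInduction with
  | zero =>
    have h := intWeights_mul_add 5 (x := 1) (y := 0) (by simp) (by simp)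
    rw [intWeights_zero] at h
    norm_num at h
    suffices IsStable 2 ({0} + (intWeights 5 1 : Multiset ℤ)) from this
    rw [h]
    -- The conic through five points.
    refine (IsStable.exceptionalDivisor.add_zeros 5 rfl).quintic (a := 0) (b := -1) (a' := 1)
      (b' := 0) (T := 0) ?_ (by norm_num) (by norm_num) (by norm_num) ?_
    · module
    · module
  | one =>
    have h := intWeights_mul_add 6 (x := 2) (y := 1) (by simp) (by simp)
    have h' := intWeights_mul_add 2 (x := 1) (y := 0) (by simp) (by simp)
    rw [intWeights_zero] at h'
    norm_num at h h'
    suffices IsStable 5 ({0} + (intWeights 13 2 : Multiset ℤ)) from this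
    rw [h, h']
    -- The line through two points.
    have h1 : IsStable 1 ({0} + 2 • {1}) := by
      refine (IsStable.exceptionalDivisor.add_zeros 2 rfl).cremona (a0 := -1) (a1 := 0) (a2 := 0)
        (T := 0) ?_ (by norm_num) ?_
      · module
      · norm_num; rfl
    refine (h1.add_zeros 6 rfl).quintic (a := 0) (b := 0) (a' := 2)
      (b' := 2) (T := {0} + 2 • {1}) ?_ (by norm_num) (by norm_num) (by norm_num) ?_
    · module
    · module
  | more k ih _ =>
    have e2 := fib_odd_add_four k
    have e3 : (Nat.fib (2 * (k + 2 + 1) + 1) : ℤ) = 3 * Nat.fib (2 * (k + 2) + 1) -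
      Nat.fib (2 * (k + 1) + 1) := fib_odd_add_four (k + 1)
    have e4 := fib_odd_add_four (k + 2)
    have hs : 0 < Nat.fib (2 * k + 1) := Nat.fib_pos.2 (by omega)
    have hsD : Nat.fib (2 * k + 1) ≤ Nat.fib (2 * (k + 1) + 1) := Nat.fib_mono (by omega)
    generalize Nat.fib (2 * (k + 2 + 2) + 1) = t at *
    generalize Nat.fib (2 * (k + 2 + 1) + 1) = p at *
    generalize Nat.fib (2 * (k + 2) + 1) = q at *
    generalize Nat.fib (2 * (k + 1) + 1) = D at *
    generalize Nat.fib (2 * k + 1) = s at *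
    obtain ⟨r, rfl⟩ : ∃ r, q = r + s := ⟨q - s, by omega⟩
    have hsr : s ≤ r := by omega
    have ht : t = 6 * (r + s) + r := by omega
    push_cast at e2
    rw [intWeights_add_self r hs] at ih
    have hw := intWeights_mul_add 1 (x := r) (y := s) (by omega) hsr
    rw [one_mul] at hw
    rw [ht, intWeights_mul_add 6 (by omega) (by omega), hw, add_comm r s]
    -- The weight `s` grows to `s + 3 (D - s) = 3 D - 2 s = r`, and six new points get multiplicity
    -- `D - s`, which the quintic raises to `q`.
    have h1 : IsStable (4 * D - 3 * s) ({(r : ℤ)} + 6 • {(D : ℤ) - s} + {0} +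
        (intWeights r s : Multiset ℤ)) := by
      refine (ih.add_zeros 6 rfl).flips_same 3 (m := s) (x := 0) (x' := D - s) (m' := r)
        (T := {0} + (intWeights r s : Multiset ℤ)) ?_ (by ring) (by push_cast; ring) ?_ ?_
      · module
      · push_cast; linarith
      · module
    refine h1.quintic (a := D - s) (b := D - s) (a' := (s + r : ℕ)) (b' := (s + r : ℕ))
      (T := {(r : ℤ)} + {0} + (intWeights r s : Multiset ℤ)) ?_ ?_ ?_ ?_ ?_
    · module
    · push_cast at e3; linarith
    · push_cast; linarith
    · push_cast; linarith
    · module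

theorem isPerfectPreStaircase_fib (e : ℕ) :
    IsPerfectPreStaircase 5 3 1 1
      (fun j => (Nat.fib (2 * (2 * j + e + 1) + 1) : ℤ)) (fun _ => 0)
      (fun j => Nat.fib (2 * (2 * j + e + 2) + 1))
      (fun j => Nat.fib (2 * (2 * j + e) + 1)) := by
  -- Every second term of a sequence with recursion factor `3` has factor `3 ^ 2 - 2 = 7 = σ + 2`.
  have rec2 : ∀ k, (Nat.fib (2 * (k + 4) + 1) : ℤ) =
      7 * Nat.fib (2 * (k + 2) + 1) - Nat.fib (2 * k + 1) := by
    intro k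
    have e2 := fib_odd_add_four k
    have e3 := fib_odd_add_four (k + 1)
    have e4 := fib_odd_add_four (k + 2)
    simp only [add_assoc, Nat.reduceAdd] at e2 e3 e4 ⊢
    linarith
  refine ⟨by norm_num, ⟨3, by norm_num⟩, ?_, ?_, ?_, ?_, ?_, ?_⟩
  · intro j
    convert rec2 (2 * j + e + 1) using 3 <;> ring_nf
  · intro j; simp
  · intro j
    convert rec2 (2 * j + e + 2) using 3 <;> ring_nf
  · intro j
    convert rec2 (2 * j + e) using 3 <;> ring_nf
  · intro j
    have := fib_odd_add_four (2 * j + e)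
    linarith
  · intro j
    refine ⟨Nat.fib_pos.2 (by omega), ?_, (isStable_fib (2 * j + e)).isExceptional⟩
    rw [Nat.Coprime, ← Nat.fib_gcd]
    -- The indices are odd and differ by `4`.
    have : Nat.gcd (2 * (2 * j + e + 2) + 1) (2 * (2 * j + e) + 1) = 1 := by
      have h : 2 * (2 * j + e + 2) + 1 = 4 + (2 * (2 * j + e) + 1) := by ring
      rw [h, Nat.gcd_add_self_left, show 4 = 2 ^ 2 by norm_num]
      exact Nat.Coprime.pow_left 2 (by simp)
    rw [this, Nat.fib_one]

theorem proposition3 :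
    (∀ n : ℕ,
      StaircasePerfect n [6, 2 * n + 1] (n + 1) (-(n - 1)) ∧
      StaircasePerfect n [2 * n + 7] (n + 2) (-(n + 4)) ∧
      StaircasePerfect n [5, 1, 2 * n + 6] (-(n + 4)) (11 * n + 31)) ∧
    (∀ n : ℕ, 1 ≤ n →
      StaircasePerfect n [6, 2 * n - 1, 2 * n + 1] (-(n - 1)) (11 * n + 2) ∧
      StaircasePerfect n [] (n + 1) (n + 2) ∧
      StaircasePerfect n [5, 1, 2 * n + 4, 2 * n + 1] (n + 2) (-(n + 4))) ∧
    (∀ e : ℕ, e < 2 →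
      IsPerfectPreStaircase 5 3 1 1
        (fun j => (Nat.fib (2 * (2 * j + e + 1) + 1) : ℤ)) (fun _ => 0)
        (fun j => Nat.fib (2 * (2 * j + e + 2) + 1))
        (fun j => Nat.fib (2 * (2 * j + e) + 1))) := by
  refine ⟨fun n => ⟨staircasePerfect_lower_l n, staircasePerfect_upper_u n,
    staircasePerfect_exceptional_u n⟩, fun n hn => ⟨?_, staircasePerfect_upper_l n,
    staircasePerfect_exceptional_l n⟩, fun e _ => isPerfectPreStaircase_fib e⟩
  obtain ⟨n, rfl⟩ := Nat.exists_eq_add_of_le' hn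
  have h := staircasePerfect_lower_u n
  rw [show 2 * (n + 1) - 1 = 2 * n + 1 by omega, show 2 * (n + 1) + 1 = 2 * n + 3 by ring]
  convert h using 1
  · push_cast; ring
  · push_cast; ring
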